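/- Let $P$ be a simple polygon in the Euclidean plane, with finitely many vertices listed in cyclic order (consecutive edges may be collinear); its interior $\operatorname{int}(P)$ is the open region enclosed by its boundary. Assume that $P$ is starshaped: there is a point $k \in \operatorname{int}(P)$ such that for every $l \in \operatorname{int}(P)$ the segment $kl$ without its endpoints lies in $\operatorname{int}(P)$. An open mobile guard of $P$ is either an edge of $P$ without its endpoints, or a diagonal of $P$ without its endpoints, where a diagonal is a segment between two non-consecutive vertices whose relative interior lies in $\operatorname{int}(P)$. A guard $g$ sees a location $l$ if there is a point $p \in g$ such that the segment $lp$ without its endpoints lies in $\operatorname{int}(P)$; two guards $g_1, g_2$ see each other if there are points $p \in g_1$ and $q \in g_2$ such that the segment $pq$ without its endpoints lies in $\operatorname{int}(P)$. Then $P$ admits a hidden open mobile guard set: there is a set $S$ of open mobile guards of $P$ such that every $l \in \operatorname{int}(P)$ is seen by at least one guard in $S$, and no two distinct guards in $S$ see each other. -/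

import Mathlib

/-- The Euclidean plane. -/
abbrev Plane : Type := EuclideanSpace ℝ (Fin 2)

namespace Polygon

variable {n : ℕ}

/-- The polygonal chain through the vertices `P 0, …, P (n - 1)` (in cyclic order) is simple:
there are at least three vertices, they are pairwise distinct, and two different edges meet at
most in a common endpoint of two consecutive edges. Consecutive edges may be collinear. -/
def IsSimple (P : Polygon Plane n) : Prop :=
  3 ≤ n ∧ Function.Injective P.vertices ∧
    ∀ i j : Fin n, i ≠ j → ∀ x ∈ P.edgeSet ℝ i ∩ P.edgeSet ℝ j,
      (j = finRotate n i ∧ x = P j) ∨ (i = finRotate n j ∧ x = P i)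

/-- The interior of the polygon, i.e. the region enclosed by its boundary: the union of the bounded
connected components of the complement of the boundary. -/
def interior (P : Polygon Plane n) : Set Plane :=
  {x | x ∈ (P.boundary ℝ)ᶜ ∧ Bornology.IsBounded (connectedComponentIn (P.boundary ℝ)ᶜ x)}

/-- Two points see each other: the segment joining them, without its endpoints, lies in the interior
of the polygon. -/
def Visible (P : Polygon Plane n) (p q : Plane) : Prop :=
  segment ℝ p q \ {p, q} ⊆ P.interior

/-- A simple polygon with an interior point that sees every point of the interior. -/
def IsStarshaped (P : Polygon Plane n) : Prop :=
  P.IsSimple ∧ ∃ k ∈ P.interior, ∀ l ∈ P.interior, P.Visible k l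

/-- An edge without its endpoints. -/
def IsOpenEdge (P : Polygon Plane n) (g : Set Plane) : Prop :=
  ∃ i : Fin n, g = openSegment ℝ (P i) (P (finRotate n i))

/-- A diagonal without its endpoints: the open segment between two distinct non-consecutive
vertices, which is required to lie in the interior of the polygon. -/
def IsOpenDiagonal (P : Polygon Plane n) (g : Set Plane) : Prop :=
  ∃ i j : Fin n, i ≠ j ∧ j ≠ finRotate n i ∧ i ≠ finRotate n j ∧
    openSegment ℝ (P i) (P j) ⊆ P.interior ∧ g = openSegment ℝ (P i) (P j)

/-- An open mobile guard is an open edge or an open diagonal. -/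
def IsOpenMobileGuard (P : Polygon Plane n) (g : Set Plane) : Prop :=
  P.IsOpenEdge g ∨ P.IsOpenDiagonal g

/-- The guard `g` sees the location `l` (weak visibility). -/
def GuardSees (P : Polygon Plane n) (g : Set Plane) (l : Plane) : Prop :=
  ∃ p ∈ g, P.Visible l p

/-- The guards `g` and `h` see each other. -/
def GuardsSeeEachOther (P : Polygon Plane n) (g h : Set Plane) : Prop :=
  ∃ p ∈ g, ∃ q ∈ h, P.Visible p q

/-- `S` is a set of open mobile guards such that every location in the interior is seen by at least
one guard in `S`. -/
def IsOpenMobileGuardSet (P : Polygon Plane n) (S : Set (Set Plane)) : Prop :=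
  (∀ g ∈ S, P.IsOpenMobileGuard g) ∧ ∀ l ∈ P.interior, ∃ g ∈ S, P.GuardSees g l

/-- `S` is hidden: no two distinct guards in `S` see each other. -/
def IsHidden (P : Polygon Plane n) (S : Set (Set Plane)) : Prop :=
  ∀ g ∈ S, ∀ h ∈ S, g ≠ h → ¬ P.GuardsSeeEachOther g h

end Polygon

/-!
Put a point of the kernel at the origin. The interior `I` then consists of the points whose segment
to the origin misses the boundary, it is open, its closure contains no further points off the
boundary, and every ray from the origin meets the boundary. These facts and the simplicity of the
boundary are all that is used (`IsStarRegion`); no Jordan curve theorem is needed.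

Call a vertex exposed if it is the first boundary point on its ray. Two independent exposed vertices
`a`, `b` are chosen such that the cone they span is maximal (`exists_maximal_pair`). In the basis
`a`, `b`, the two mixed open quadrants then contain no exposed vertex. The guards are the open
segments between consecutive points of the lower hull of the exposed vertices in the cone, that is,
of the part of the boundary of their convex hull that faces the origin (`IsHullPair`).

* The triangle of the origin and a hull pair contains no boundary point below its outer side,
  since an edge entering it could be followed to an exposed vertex below the hull
  (`one_le_of_mem_bdry`). So a hull segment is an edge or a diagonal
  (`adj_or_subset_of_hullPair`).
* A hull segment sees all of `I` in its cone and, through the origin, all of `I` in the opposite cone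
  (`exists_sees_of_mem_cone`, `exists_sees_of_mem_neg_cone`). The cones of the hull pairs fill the
  cone of `a` and `b` (`exists_hullPair`), so that only the mixed quadrants remain.
* As there are no exposed vertices in a mixed quadrant, a single edge bounds `I` there. It runs from
  the ray of `b` to the ray opposite to `a` (`exists_edge_across`). If it ends at `b`, then it is
  below the line of the hull segment at `b`, since `a` is not below this line, and this hull segment
  sees the quadrant (`exists_sees_of_edge_at`). Otherwise there is a radial edge at `b`, which sees
  the quadrant and is added to the guards. The other quadrant is treated in the same way.
* Two hull segments do not see each other, because a segment between them passes through or beyond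
  a hull vertex (`not_subset_of_hullPair`). A radial edge at `b` is hidden from everything on the
  side of `a` of its ray, because otherwise there would be no room for the second edge at `b`
  (`not_subset_of_radial`).
-/

open Set Filter Topology

namespace Starshaped

/-! ### Coordinates in the plane -/

/-- The cross product of two vectors of the plane. -/
def cross (x y : Plane) : ℝ := x 0 * y 1 - x 1 * y 0

lemma cross_self (x : Plane) : cross x x = 0 := by unfold cross; ring

lemma cross_swap (x y : Plane) : cross y x = -cross x y := by unfold cross; ring

lemma cross_comb (u w : Plane) (a b c d : ℝ) :
    cross (a • u + b • w) (c • u + d • w) = (a * d - b * c) * cross u w := by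
  simp only [cross, PiLp.add_apply, PiLp.smul_apply, smul_eq_mul]; ring

lemma cross_add_smul (x y z : Plane) (t : ℝ) :
    cross x (y + t • z) = cross x y + t * cross x z := by
  simp only [cross, PiLp.add_apply, PiLp.smul_apply, smul_eq_mul]; ring

/-- The linear map `x ↦ cross u x`. -/
def crossₗ (u : Plane) : Plane →ₗ[ℝ] ℝ where
  toFun := cross u
  map_add' x y := by simp only [cross, PiLp.add_apply]; ring
  map_smul' t x := by
    simp only [cross, PiLp.smul_apply, smul_eq_mul, RingHom.id_apply]; ring

/-- The coordinate functionals `f`, `g` of the basis `u`, `w`. -/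
def IsDual (u w : Plane) (f g : Plane →ₗ[ℝ] ℝ) : Prop :=
  f u = 1 ∧ f w = 0 ∧ g u = 0 ∧ g w = 1 ∧ ∀ x, x = f x • u + g x • w

lemma exists_isDual {u w : Plane} (h : cross u w ≠ 0) : ∃ f g, IsDual u w f g := by
  refine ⟨(-(cross u w)⁻¹) • crossₗ w, (cross u w)⁻¹ • crossₗ u, ?_, ?_, ?_, ?_, fun x => ?_⟩
  · change -(cross u w)⁻¹ * cross w u = 1
    rw [cross_swap u w]; field_simp
  · change -(cross u w)⁻¹ * cross w w = 0
    simp [cross_self]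
  · change (cross u w)⁻¹ * cross u u = 0
    simp [cross_self]
  · change (cross u w)⁻¹ * cross u w = 1
    field_simp
  · change x = (-(cross u w)⁻¹ * cross w x) • u + ((cross u w)⁻¹ * cross u x) • w
    ext i
    simp only [PiLp.add_apply, PiLp.smul_apply, smul_eq_mul]
    field_simp
    unfold cross
    fin_cases i <;> simp <;> ring

lemma IsDual.symm {u w : Plane} {f g : Plane →ₗ[ℝ] ℝ} (h : IsDual u w f g) :
    IsDual w u g f :=
  ⟨h.2.2.2.1, h.2.2.1, h.2.1, h.1, fun x => by rw [add_comm]; exact h.2.2.2.2 x⟩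

lemma IsDual.cross_eq {u w : Plane} {f g : Plane →ₗ[ℝ] ℝ} (h : IsDual u w f g) (x y : Plane) :
    cross x y = (f x * g y - g x * f y) * cross u w := by
  conv_lhs => rw [h.2.2.2.2 x, h.2.2.2.2 y, cross_comb]

lemma eq_smul_of_cross_eq_zero {x y : Plane} (hx : x ≠ 0) (h : cross x y = 0) :
    ∃ t : ℝ, y = t • x := by
  unfold cross at h
  by_cases h0 : x 0 = 0
  · have h1 : x 1 ≠ 0 := by
      intro h1; apply hx; ext i; fin_cases i <;> simp [h0, h1]
    refine ⟨y 1 / x 1, ?_⟩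
    have : y 0 = 0 := by
      rw [h0] at h; have : x 1 * y 0 = 0 := by linarith
      exact (mul_eq_zero.1 this).resolve_left h1
    ext i; fin_cases i
    · simp [h0, this]
    · simp [h1]
  · refine ⟨y 0 / x 0, ?_⟩
    ext i; fin_cases i
    · simp [h0]
    · simp only [PiLp.smul_apply, smul_eq_mul, Fin.mk_one]
      field_simp; linarith

lemma cross_smul_right (x y : Plane) (t : ℝ) : cross x (t • y) = t * cross x y := by
  simp only [cross, PiLp.smul_apply, smul_eq_mul]; ring

lemma continuous_functional (f : Plane →ₗ[ℝ] ℝ) : Continuous f :=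
  f.continuous_of_finiteDimensional

/-- A functional on a point of a segment. -/
lemma map_convex (f : Plane →ₗ[ℝ] ℝ) (x y : Plane) (s : ℝ) :
    f ((1 - s) • x + s • y) = (1 - s) * f x + s * f y := by
  simp

lemma mem_segment_iff {x y z : Plane} :
    z ∈ segment ℝ x y ↔ ∃ s : ℝ, 0 ≤ s ∧ s ≤ 1 ∧ z = (1 - s) • x + s • y := by
  rw [segment_eq_image]
  constructor
  · rintro ⟨s, hs, rfl⟩; exact ⟨s, hs.1, hs.2, rfl⟩
  · rintro ⟨s, h0, h1, rfl⟩; exact ⟨s, ⟨h0, h1⟩, rfl⟩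

lemma mem_openSegment_iff {x y z : Plane} :
    z ∈ openSegment ℝ x y ↔ ∃ s : ℝ, 0 < s ∧ s < 1 ∧ z = (1 - s) • x + s • y := by
  rw [openSegment_eq_image]
  constructor
  · rintro ⟨s, hs, rfl⟩; exact ⟨s, hs.1, hs.2, rfl⟩
  · rintro ⟨s, h0, h1, rfl⟩; exact ⟨s, ⟨h0, h1⟩, rfl⟩

lemma le_endpoint (f : Plane →ₗ[ℝ] ℝ) {x c d : Plane} (hx : x ∈ segment ℝ c d) :
    f c ≤ f x ∨ f d ≤ f x := by
  obtain ⟨s, s0, s1, rfl⟩ := mem_segment_iff.1 hx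
  by_contra! h
  simp only [map_convex] at h
  rcases s0.lt_or_eq with s0 | rfl
  · nlinarith [mul_pos s0 (sub_pos.2 h.2), mul_nonneg (sub_nonneg.2 s1) (sub_pos.2 h.1).le]
  · linarith [h.1]

/-- A continuous function on a segment that is nonnegative at one end and nonpositive at the
other vanishes somewhere on it. -/
lemma exists_zero_on_segment {m : Plane → ℝ} (hm : Continuous m) {x y : Plane}
    (hx : 0 ≤ m x) (hy : m y ≤ 0) : ∃ s : ℝ, 0 ≤ s ∧ s ≤ 1 ∧ m ((1 - s) • x + s • y) = 0 := by
  have hc : ContinuousOn (fun s : ℝ => m ((1 - s) • x + s • y)) (Icc 0 1) := by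
    apply Continuous.continuousOn; fun_prop
  have := intermediate_value_Icc' zero_le_one hc
  simp only [sub_zero, one_smul, zero_smul, add_zero, sub_self, zero_add] at this
  obtain ⟨s, hs, h⟩ := this ⟨hy, hx⟩
  exact ⟨s, hs.1, hs.2, h⟩

/-! ### Starshaped regions bounded by a simple chain -/

/-- The union of the edges of a graph drawn in the plane with straight edges. -/
def bdry (Adj : Plane → Plane → Prop) : Set Plane :=
  {x | ∃ c d, Adj c d ∧ x ∈ segment ℝ c d}

/-- The data of a polygon that is starshaped around the origin, stripped of the cyclic order of its
vertices: the set `V` of vertices, the adjacency relation `Adj` of the edges, and the region `I`,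
which consists of the points whose segment to the origin misses the boundary. -/
structure IsStarRegion (V : Set Plane) (Adj : Plane → Plane → Prop) (I : Set Plane) : Prop where
  finite : V.Finite
  symm : ∀ {c d}, Adj c d → Adj d c
  left_mem : ∀ {c d}, Adj c d → c ∈ V
  ne : ∀ {c d}, Adj c d → c ≠ d
  exists_adj : ∀ {v}, v ∈ V → ∃ d, Adj v d
  exists_ne_adj : ∀ {v f}, Adj v f → ∃ d, d ≠ f ∧ Adj v d
  /-- A common point of two different edges is an endpoint of the first, hence of both. -/
  simple : ∀ {c d c' d' x}, Adj c d → Adj c' d' → x ∈ segment ℝ c d → x ∈ segment ℝ c' d' →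
    (c' = c ∧ d' = d) ∨ (c' = d ∧ d' = c) ∨ x = c ∨ x = d
  zero_notMem : (0 : Plane) ∉ bdry Adj
  mem_iff : ∀ {x}, x ∈ I ↔ ∀ t : ℝ, 0 ≤ t → t ≤ 1 → t • x ∉ bdry Adj
  hits : ∀ {x : Plane}, x ≠ 0 → ∃ t : ℝ, 0 < t ∧ t • x ∈ bdry Adj
  isOpen : IsOpen I
  closure_sub : ∀ {x}, x ∈ closure I → x ∉ bdry Adj → x ∈ I

/-- No point of the segment from the origin to `x`, except possibly `x`, is on the boundary. -/
def Clear (Adj : Plane → Plane → Prop) (x : Plane) : Prop :=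
  ∀ t : ℝ, 0 ≤ t → t < 1 → t • x ∉ bdry Adj

/-- The vertices that are the first point of the boundary on their ray from the origin. -/
def exposed (V : Set Plane) (Adj : Plane → Plane → Prop) : Set Plane :=
  {v | v ∈ V ∧ Clear Adj v}

namespace IsStarRegion

variable {V : Set Plane} {Adj : Plane → Plane → Prop} {I : Set Plane}

lemma mem_bdry (H : IsStarRegion V Adj I) {v : Plane} (hv : v ∈ V) : v ∈ bdry Adj := by
  obtain ⟨d, hd⟩ := H.exists_adj hv
  exact ⟨v, d, hd, left_mem_segment ℝ v d⟩

lemma right_mem (H : IsStarRegion V Adj I) {c d : Plane} (h : Adj c d) : d ∈ V :=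
  H.left_mem (H.symm h)

lemma vertex_on_edge (H : IsStarRegion V Adj I) {v c d : Plane} (hv : v ∈ V) (h : Adj c d)
    (hs : v ∈ segment ℝ c d) : v = c ∨ v = d := by
  obtain ⟨e, he⟩ := H.exists_adj hv
  rcases H.simple h he hs (left_mem_segment ℝ v e) with h | h | h | h
  · exact Or.inl h.1
  · exact Or.inr h.1
  · exact Or.inl h
  · exact Or.inr h

lemma isClosed_bdry (H : IsStarRegion V Adj I) : IsClosed (bdry Adj) := by
  have : bdry Adj = ⋃ e ∈ {e : Plane × Plane | Adj e.1 e.2}, segment ℝ e.1 e.2 := by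
    ext x; simp [bdry]
  rw [this]
  apply Set.Finite.isClosed_biUnion
  · exact (H.finite.prod H.finite).subset fun e he => ⟨H.left_mem he, H.right_mem he⟩
  · intro e _
    rw [← convexHull_pair]
    exact ((Set.toFinite {e.1, e.2}).isCompact_convexHull ℝ).isClosed

lemma ne_zero_of_mem_bdry (H : IsStarRegion V Adj I) {x : Plane} (hx : x ∈ bdry Adj) : x ≠ 0 := by
  rintro rfl; exact H.zero_notMem hx

lemma exists_first_hit (H : IsStarRegion V Adj I) {x : Plane} (hx : x ≠ 0) :
    ∃ t : ℝ, 0 < t ∧ t • x ∈ bdry Adj ∧ Clear Adj (t • x) := by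
  obtain ⟨t₀, ht₀, hb⟩ := H.hits hx
  have hc : IsCompact (Icc 0 t₀ ∩ (fun t : ℝ => t • x) ⁻¹' bdry Adj) :=
    isCompact_Icc.inter_right (H.isClosed_bdry.preimage (by fun_prop))
  obtain ⟨t, ht, hmin⟩ := hc.exists_isLeast ⟨t₀, ⟨ht₀.le, le_rfl⟩, hb⟩
  have htpos : 0 < t := by
    rcases ht.1.1.lt_or_eq with h | h
    · exact h
    · exfalso; have := ht.2; rw [← h] at this
      simp only [mem_preimage, zero_smul] at this
      exact H.zero_notMem this
  refine ⟨t, htpos, ht.2, fun s hs0 hs1 hs => ?_⟩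
  rw [smul_smul] at hs
  have hlt : s * t < t := by nlinarith
  have := hmin ⟨⟨by positivity, hlt.le.trans ht.1.2⟩, hs⟩
  linarith

lemma smul_notMem (H : IsStarRegion V Adj I) {v : Plane} (hv : v ∈ bdry Adj) {s : ℝ}
    (hs : 1 ≤ s) : s • v ∉ I := by
  intro h
  refine H.mem_iff.1 h s⁻¹ (by positivity) (inv_le_one_of_one_le₀ hs) ?_
  rwa [smul_smul, inv_mul_cancel₀ (by positivity), one_smul]

lemma notMem_bdry (H : IsStarRegion V Adj I) {x : Plane} (hx : x ∈ I) : x ∉ bdry Adj := by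
  intro h; exact H.smul_notMem h le_rfl (by simpa using hx)

lemma smul_mem (H : IsStarRegion V Adj I) {x : Plane} (hx : x ∈ I) {s : ℝ} (h0 : 0 ≤ s)
    (h1 : s ≤ 1) : s • x ∈ I := by
  refine H.mem_iff.2 fun t ht0 ht1 => ?_
  rw [smul_smul]
  exact H.mem_iff.1 hx _ (by positivity) (by nlinarith)

lemma smul_mem_of_clear (H : IsStarRegion V Adj I) {x : Plane} (hx : Clear Adj x) {s : ℝ}
    (h0 : 0 ≤ s) (h1 : s < 1) : s • x ∈ I := by
  refine H.mem_iff.2 fun t ht0 ht1 => ?_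
  rw [smul_smul]
  exact hx _ (by positivity) (by nlinarith)

/-- There is at most one exposed vertex on each ray from the origin. -/
lemma exposed_unique (H : IsStarRegion V Adj I) {v w : Plane} (hv : v ∈ exposed V Adj)
    (hw : w ∈ exposed V Adj) {s : ℝ} (hs : 0 < s) (h : w = s • v) : w = v := by
  rcases lt_trichotomy s 1 with h1 | h1 | h1
  · exact absurd (h ▸ H.mem_bdry hw.1) (hv.2 s hs.le h1)
  · rw [h, h1, one_smul]
  · refine absurd (H.mem_bdry hv.1) ?_
    have : v = s⁻¹ • w := by rw [h, smul_smul, inv_mul_cancel₀ hs.ne', one_smul]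
    rw [this]
    exact hw.2 _ (by positivity) (inv_lt_one_of_one_lt₀ h1)

/-! ### Triangles with two clear sides -/

/-- An edge that enters the open triangle `0, u, w`, whose sides at the origin are clear, can be
followed, not away from the origin, to an endpoint inside the triangle. -/
lemma exists_vertex_below (H : IsStarRegion V Adj I) {u w : Plane} {f g : Plane →ₗ[ℝ] ℝ}
    (hd : IsDual u w f g) (hu : Clear Adj u) (hw : Clear Adj w) {x : Plane} (hx : x ∈ bdry Adj)
    (hf : 0 < f x) (hg : 0 < g x) (h1 : f x + g x < 1) :
    ∃ v ∈ V, 0 < f v ∧ 0 < g v ∧ f v + g v ≤ f x + g x := by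
  -- One of the two endpoints of the edge is not farther from the origin, in the direction `f + g`.
  obtain ⟨c, d, hcd, hxc, hle⟩ : ∃ c d, Adj c d ∧ x ∈ segment ℝ c d ∧ f d + g d ≤ f x + g x := by
    obtain ⟨c, d, hcd, hs⟩ := hx
    by_cases h : f d + g d ≤ f x + g x
    · exact ⟨c, d, hcd, hs, h⟩
    · refine ⟨d, c, H.symm hcd, by rwa [segment_symm], ?_⟩
      exact (le_endpoint (f + g) hs).resolve_right h
  refine ⟨d, H.right_mem hcd, ?_⟩
  by_contra hcon
  have hneg : min (f d) (g d) ≤ 0 := by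
    by_contra! h'
    exact hcon ⟨(lt_min_iff.1 h').1, (lt_min_iff.1 h').2, hle⟩
  obtain ⟨s, s0, s1, hs⟩ := exists_zero_on_segment (m := fun z => min (f z) (g z))
    ((continuous_functional f).min (continuous_functional g)) (x := x) (y := d)
    (le_min hf.le hg.le) hneg
  set z := (1 - s) • x + s • d with hz
  have hzb : z ∈ bdry Adj := by
    refine ⟨c, d, hcd, (convex_segment c d).segment_subset hxc (right_mem_segment ℝ c d) ?_⟩
    exact mem_segment_iff.2 ⟨s, s0, s1, hz⟩
  have hzl : f z + g z < 1 := by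
    simp only [hz, map_convex]; nlinarith
  have hzd := hd.2.2.2.2 z
  rcases min_choice (f z) (g z) with h | h
  · have h0 : f z = 0 := by rw [← h]; exact hs
    have h2 : 0 ≤ g z := by rw [← hs]; exact min_le_right _ _
    rw [h0, zero_smul, zero_add] at hzd
    rw [hzd] at hzb
    exact hw _ h2 (by linarith) hzb
  · have h0 : g z = 0 := by rw [← h]; exact hs
    have h2 : 0 ≤ f z := by rw [← hs]; exact min_le_left _ _
    rw [h0, zero_smul, add_zero] at hzd
    rw [hzd] at hzb
    exact hu _ h2 (by linarith) hzb

/-- A triangle `0, u, w` with clear sides at the origin contains no boundary point below its side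
`u, w`, unless it contains an exposed vertex there. -/
lemma one_le_of_mem_bdry (H : IsStarRegion V Adj I) {u w : Plane} {f g : Plane →ₗ[ℝ] ℝ}
    (hd : IsDual u w f g) (hu : Clear Adj u) (hw : Clear Adj w)
    (hexp : ∀ v ∈ exposed V Adj, 0 < f v → 0 < g v → 1 ≤ f v + g v) {x : Plane}
    (hx : x ∈ bdry Adj) (hf : 0 ≤ f x) (hg : 0 ≤ g x) : 1 ≤ f x + g x := by
  by_contra! hlt
  have hxd := hd.2.2.2.2 x
  rcases hf.lt_or_eq with hf | hf
  swap
  · rw [← hf, zero_smul, zero_add] at hxd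
    rw [hxd] at hx
    exact hw _ hg (by linarith) hx
  rcases hg.lt_or_eq with hg | hg
  swap
  · rw [← hg, zero_smul, add_zero] at hxd
    rw [hxd] at hx
    exact hu _ hf.le (by linarith) hx
  obtain ⟨v₀, hv₀, h1, h2, h3⟩ := H.exists_vertex_below hd hu hw hx hf hg hlt
  have hfin : {v | v ∈ V ∧ 0 < f v ∧ 0 < g v ∧ f v + g v < 1}.Finite :=
    H.finite.subset fun v hv => hv.1
  obtain ⟨v, ⟨hv, hvf, hvg, hvl⟩, hmin⟩ := Set.exists_min_image _ (fun v => f v + g v) hfin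
    ⟨v₀, hv₀, h1, h2, by linarith⟩
  refine absurd (hexp v ⟨hv, fun t t0 t1 ht => ?_⟩ hvf hvg) (by linarith)
  rcases t0.lt_or_eq with t0 | t0
  swap
  · rw [← t0, zero_smul] at ht; exact H.zero_notMem ht
  have hlam : t * f v + t * g v < f v + g v := by nlinarith
  obtain ⟨v', hv', h1', h2', h3'⟩ := H.exists_vertex_below hd hu hw ht
    (by simp only [map_smul, smul_eq_mul]; positivity)
    (by simp only [map_smul, smul_eq_mul]; positivity)
    (by simp only [map_smul, smul_eq_mul]; linarith)
  simp only [map_smul, smul_eq_mul] at h3'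
  have := hmin v' ⟨hv', h1', h2', by linarith⟩
  linarith

/-- The conclusion of `one_le_of_mem_bdry` in terms of the region. -/
lemma mem_of_lt_one (H : IsStarRegion V Adj I) {u w : Plane} {f g : Plane →ₗ[ℝ] ℝ}
    (hd : IsDual u w f g) (hu : Clear Adj u) (hw : Clear Adj w)
    (hexp : ∀ v ∈ exposed V Adj, 0 < f v → 0 < g v → 1 ≤ f v + g v) {x : Plane}
    (hf : 0 ≤ f x) (hg : 0 ≤ g x) (h1 : f x + g x < 1) : x ∈ I := by
  refine H.mem_iff.2 fun t t0 t1 ht => ?_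
  have := H.one_le_of_mem_bdry hd hu hw hexp ht
    (by simp only [map_smul, smul_eq_mul]; positivity)
    (by simp only [map_smul, smul_eq_mul]; positivity)
  simp only [map_smul, smul_eq_mul] at this
  nlinarith

end IsStarRegion

end Starshaped

namespace Starshaped
namespace IsStarRegion

variable {V : Set Plane} {Adj : Plane → Plane → Prop} {I : Set Plane}

/-! ### Following an edge from one of its visible points -/

/-- Let `y`, `y'` be points of an edge `p q`, where `y` is visible from the origin and is not a
vertex. A boundary point inside the triangle `0, y, y'` lies on an edge that has an endpoint in this
triangle which is closer to the ray of `y` in angle, or lies on the same ray and is not farther from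
the origin. The reason is that the edge can leave the triangle neither through `p q` nor through the
clear side `0, y`. -/
lemma exists_vertex_toward (H : IsStarRegion V Adj I) {p q y y' : Plane} {f g : Plane →ₗ[ℝ] ℝ}
    (hd : IsDual y y' f g) (hpq : Adj p q) (hy : y ∈ segment ℝ p q) (hy' : y' ∈ segment ℝ p q)
    (hcl : Clear Adj y) (hyV : y ∉ V) {x : Plane} (hx : x ∈ bdry Adj)
    (hf : 0 ≤ f x) (hg : 0 < g x) (h1 : f x + g x < 1) :
    ∃ v ∈ V, 0 ≤ f v ∧ 0 < g v ∧ f v + g v ≤ 1 ∧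
      (f x * g v < g x * f v ∨ ∃ κ : ℝ, 0 < κ ∧ κ ≤ 1 ∧ v = κ • x) := by
  by_cases hxV : x ∈ V
  · exact ⟨x, hxV, hf, hg, h1.le, Or.inr ⟨1, one_pos, le_rfl, (one_smul ℝ x).symm⟩⟩
  obtain ⟨s₁, s₁0, s₁1, hs₁⟩ := mem_segment_iff.1 hy
  obtain ⟨s₂, s₂0, s₂1, hs₂⟩ := mem_segment_iff.1 hy'
  have s₁0' : 0 < s₁ := by
    rcases s₁0.lt_or_eq with h | h
    · exact h
    · refine absurd (H.left_mem hpq) ?_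
      rw [← h] at hs₁; simp only [sub_zero, one_smul, zero_smul, add_zero] at hs₁
      rwa [← hs₁]
  have s₁1' : s₁ < 1 := by
    rcases s₁1.lt_or_eq with h | h
    · exact h
    · refine absurd (H.right_mem hpq) ?_
      rw [h] at hs₁; simp only [sub_self, one_smul, zero_smul, zero_add] at hs₁
      rwa [← hs₁]
  -- The edge `p q` lies on the line `f + g = 1`.
  have hline : ∀ z ∈ segment ℝ p q, f z + g z = 1 := by
    have e1 : (1 - s₁) * (f p + g p) + s₁ * (f q + g q) = 1 := by
      have := hd.1; have h2 := hd.2.2.1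
      rw [hs₁, map_convex] at this h2; linarith
    have e2 : (1 - s₂) * (f p + g p) + s₂ * (f q + g q) = 1 := by
      have := hd.2.1; have h2 := hd.2.2.2.1
      rw [hs₂, map_convex] at this h2; linarith
    have hne : s₁ - s₂ ≠ 0 := by
      intro h
      have h12 : s₁ = s₂ := by linarith
      have hyy : y = y' := by rw [hs₁, hs₂, h12]
      have := hd.1; rw [hyy, hd.2.1] at this; norm_num at this
    have e3 : f q + g q = f p + g p := by
      have : (s₁ - s₂) * ((f q + g q) - (f p + g p)) = 0 := by linarith
      have := (mul_eq_zero.1 this).resolve_left hne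
      linarith
    rintro z hz
    obtain ⟨s, s0, s1, rfl⟩ := mem_segment_iff.1 hz
    simp only [map_convex]
    rw [e3] at e1
    linear_combination e1 + s * e3
  -- No other edge passes through the half-open segment from `y` to `y'`.
  have hcross : ∀ c d, Adj c d → x ∈ segment ℝ c d → ∀ t : ℝ, 0 ≤ t → t < 1 →
      (1 - t) • y + t • y' ∉ segment ℝ c d := by
    intro c d hcd hxc t t0 t1 hz
    have hzo : (1 - t) • y + t • y' ∈ openSegment ℝ p q := by
      refine mem_openSegment_iff.2 ⟨(1 - t) * s₁ + t * s₂, ?_, ?_, ?_⟩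
      · have := mul_pos (sub_pos.2 t1) s₁0'; positivity
      · nlinarith [mul_pos (sub_pos.2 t1) (sub_pos.2 s₁1')]
      · rw [hs₁, hs₂]; module
    rcases H.simple hpq hcd (openSegment_subset_segment ℝ p q hzo) hz with h | h | h | h
    · rw [h.1, h.2] at hxc; have := hline x hxc; linarith
    · rw [h.1, h.2, segment_symm] at hxc; have := hline x hxc; linarith
    · rw [h] at hzo; exact H.ne hpq ((left_mem_openSegment_iff).1 hzo)
    · rw [h] at hzo; exact H.ne hpq ((right_mem_openSegment_iff).1 hzo)
  obtain ⟨c, d, hcd, hxs⟩ := hx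
  set ψ : Plane →ₗ[ℝ] ℝ := f x • g - g x • f with hψ
  have hψv : ∀ z, ψ z = f x * g z - g x * f z := fun z => by simp [hψ]
  have hψx : ψ x = 0 := by rw [hψv]; ring
  by_cases hneg : ∃ c d, Adj c d ∧ x ∈ segment ℝ c d ∧ ψ d < 0
  · obtain ⟨c, d, hcd, hxs, hψd⟩ := hneg
    have key : 0 < g d ∧ f d + g d ≤ 1 := by
      by_contra hcon
      have hm : min (g d) (1 - (f d + g d)) ≤ 0 := by
        by_contra! h
        exact hcon ⟨(lt_min_iff.1 h).1, by linarith [(lt_min_iff.1 h).2]⟩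
      obtain ⟨s, s0, s1, hs⟩ := exists_zero_on_segment
        (m := fun z => min (g z) (1 - (f z + g z)))
        ((continuous_functional g).min (continuous_const.sub
          ((continuous_functional f).add (continuous_functional g)))) (x := x) (y := d)
        (le_min hg.le (by linarith)) hm
      set z := (1 - s) • x + s • d with hz
      have hzs : z ∈ segment ℝ c d :=
        (convex_segment c d).segment_subset hxs (right_mem_segment ℝ c d)
          (mem_segment_iff.2 ⟨s, s0, s1, hz⟩)
      have hψz : ψ z = s * ψ d := by rw [hz, map_convex, hψx]; ring
      have hzd := hd.2.2.2.2 z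
      have hgz : 0 ≤ g z := by rw [← hs]; exact min_le_left _ _
      have hlz : 0 ≤ 1 - (f z + g z) := by rw [← hs]; exact min_le_right _ _
      rcases min_choice (g z) (1 - (f z + g z)) with h | h
      · have h0 : g z = 0 := by rw [← h]; exact hs
        have hfz : 0 ≤ f z := by
          have : ψ z ≤ 0 := by rw [hψz]; nlinarith
          rw [hψv, h0] at this
          by_contra! h'
          nlinarith
        rw [h0, zero_smul, add_zero] at hzd
        rcases (show f z ≤ 1 by linarith).lt_or_eq with h2 | h2
        · refine hcl _ hfz h2 ?_
          rw [← hzd]; exact ⟨c, d, hcd, hzs⟩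
        · refine hcross c d hcd hxs 0 le_rfl one_pos ?_
          rw [h2, one_smul] at hzd
          simpa [← hzd] using hzs
      · have h0 : 1 - (f z + g z) = 0 := by rw [← h]; exact hs
        have hspos : 0 < s := by
          rcases s0.lt_or_eq with h' | h'
          · exact h'
          · exfalso
            rw [hz, ← h'] at h0
            simp only [sub_zero, one_smul, zero_smul, add_zero] at h0
            linarith
        have hψz' : ψ z < 0 := by rw [hψz]; nlinarith
        rw [hψv] at hψz'
        have hfz : 0 < f z := by
          by_contra! h'
          nlinarith [mul_nonneg hf hgz]
        refine hcross c d hcd hxs (g z) hgz (by linarith) ?_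
        have : 1 - g z = f z := by linarith
        rw [this, ← hzd]; exact hzs
    refine ⟨d, H.right_mem hcd, ?_, key.1, key.2, Or.inl ?_⟩
    · rw [hψv] at hψd
      by_contra! h'
      nlinarith [mul_nonneg hf key.1.le]
    · rw [hψv] at hψd; linarith
  · -- Otherwise the edge is radial, and its endpoint nearest to the origin will do.
    push Not at hneg
    have hψd := hneg c d hcd hxs
    have hψc := hneg d c (H.symm hcd) (by rwa [segment_symm])
    obtain ⟨s, s0, s1, hs⟩ := mem_segment_iff.1 hxs
    have s0' : 0 < s := by
      rcases s0.lt_or_eq with h | h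
      · exact h
      · refine absurd (H.left_mem hcd) ?_
        rw [← h] at hs; simp only [sub_zero, one_smul, zero_smul, add_zero] at hs
        rwa [← hs]
    have s1' : s < 1 := by
      rcases s1.lt_or_eq with h | h
      · exact h
      · refine absurd (H.right_mem hcd) ?_
        rw [h] at hs; simp only [sub_self, one_smul, zero_smul, zero_add] at hs
        rwa [← hs]
    have hsum : (1 - s) * ψ c + s * ψ d = 0 := by
      rw [← map_convex, ← hs, hψx]
    have hc0 : ψ c = 0 := by
      have := mul_nonneg s0'.le hψd
      by_contra h
      have := mul_pos (sub_pos.2 s1') (lt_of_le_of_ne hψc (Ne.symm h))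
      linarith
    have hd0 : ψ d = 0 := by
      rw [hc0, mul_zero, zero_add] at hsum
      exact (mul_eq_zero.1 hsum).resolve_left s0'.ne'
    obtain ⟨v, hv, hvs, hψ0, hvl⟩ : ∃ v ∈ V, v ∈ segment ℝ c d ∧ ψ v = 0 ∧
        f v + g v ≤ f x + g x := by
      rcases le_endpoint (f + g) hxs with h | h
      · exact ⟨c, H.left_mem hcd, left_mem_segment ℝ c d, hc0, h⟩
      · exact ⟨d, H.right_mem hcd, right_mem_segment ℝ c d, hd0, h⟩
    rw [hψv] at hψ0
    set κ := g v / g x with hκ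
    have hgv : g v = κ * g x := by rw [hκ]; field_simp
    have hfv : f v = κ * f x := by
      rw [hκ]; field_simp; linarith
    have hvx : v = κ • x := by
      calc v = f v • y + g v • y' := hd.2.2.2.2 v
        _ = κ • (f x • y + g x • y') := by rw [hfv, hgv]; module
        _ = κ • x := by rw [← hd.2.2.2.2 x]
    have hκ1 : κ ≤ 1 := by
      rw [hgv, hfv] at hvl
      by_contra! h
      nlinarith
    have hκ0 : 0 < κ := by
      by_contra! h
      refine H.zero_notMem ⟨c, d, hcd, (convex_segment c d).segment_subset hvs hxs ?_⟩
      refine mem_segment_iff.2 ⟨-κ / (1 - κ), div_nonneg (by linarith) (by linarith), ?_, ?_⟩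
      · rw [div_le_one (by linarith)]; linarith
      · rw [hvx, smul_smul, ← add_smul]
        have : (1 - -κ / (1 - κ)) * κ + -κ / (1 - κ) = 0 := by
          have : (1 - κ) ≠ 0 := by linarith
          field_simp; ring
        rw [this, zero_smul]
    refine ⟨v, hv, ?_, ?_, by linarith, Or.inr ⟨κ, hκ0, hκ1, hvx⟩⟩
    · rw [hfv]; positivity
    · rw [hgv]; positivity

/-- A point `y'` of the edge of a visible non-vertex `y` is again visible and no vertex, if the cone
spanned by `y` and `y'` contains no exposed vertex. -/
lemma clear_of_mem_edge (H : IsStarRegion V Adj I) {p q y y' : Plane} {f g : Plane →ₗ[ℝ] ℝ}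
    (hd : IsDual y y' f g) (hpq : Adj p q) (hy : y ∈ segment ℝ p q) (hy' : y' ∈ segment ℝ p q)
    (hcl : Clear Adj y) (hyV : y ∉ V) (hexp : ∀ v ∈ exposed V Adj, 0 ≤ f v → ¬ 0 < g v) :
    y' ∉ V ∧ Clear Adj y' := by
  set D := {v | v ∈ V ∧ 0 ≤ f v ∧ 0 < g v ∧ f v + g v ≤ 1} with hD
  have hDfin : D.Finite := H.finite.subset fun v hv => hv.1
  rcases D.eq_empty_or_nonempty with hDe | hDn
  · constructor
    · intro h
      have : y' ∈ D := ⟨h, by rw [hd.2.1], by rw [hd.2.2.2.1]; norm_num,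
        by rw [hd.2.1, hd.2.2.2.1]; norm_num⟩
      rw [hDe] at this; exact this
    · intro t t0 t1 ht
      rcases t0.lt_or_eq with t0 | t0
      swap
      · rw [← t0, zero_smul] at ht; exact H.zero_notMem ht
      obtain ⟨v, hv, h1, h2, h3, -⟩ := H.exists_vertex_toward hd hpq hy hy' hcl hyV ht
        (by simp [hd.2.1]) (by simp [hd.2.2.2.1, t0]) (by simp [hd.2.1, hd.2.2.2.1, t1])
      have : v ∈ D := ⟨hv, h1, h2, h3⟩
      rw [hDe] at this; exact this.elim
  · -- A vertex in the triangle of minimal angle to `y`, and nearest among those, is exposed.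
    exfalso
    obtain ⟨v₀, hv₀, hmax⟩ := Set.exists_max_image D (fun v => f v / g v) hDfin hDn
    obtain ⟨v, ⟨⟨hv, hvf, hvg, hvl⟩, hvr⟩, hmin⟩ := Set.exists_min_image
      (D ∩ {v | f v / g v = f v₀ / g v₀}) g (hDfin.subset inter_subset_left) ⟨v₀, hv₀, rfl⟩
    refine hexp v ⟨hv, fun t t0 t1 ht => ?_⟩ hvf hvg
    rcases t0.lt_or_eq with t0 | t0
    swap
    · rw [← t0, zero_smul] at ht; exact H.zero_notMem ht
    obtain ⟨v', hv', h1, h2, h3, h4⟩ := H.exists_vertex_toward hd hpq hy hy' hcl hyV ht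
      (by simp only [map_smul, smul_eq_mul]; positivity)
      (by simp only [map_smul, smul_eq_mul]; positivity)
      (by simp only [map_smul, smul_eq_mul]; nlinarith)
    simp only [map_smul, smul_eq_mul] at h4
    rcases h4 with h4 | ⟨κ, κ0, κ1, h4⟩
    · have := hmax v' ⟨hv', h1, h2, h3⟩
      simp only [mem_ofPred_eq] at this hvr
      rw [← hvr, div_le_div_iff₀ h2 hvg] at this
      nlinarith
    · have hfv : f v' = κ * t * f v := by rw [h4]; simp [mul_assoc]
      have hgv : g v' = κ * t * g v := by rw [h4]; simp [mul_assoc]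
      have hlt : κ * t < 1 := by nlinarith
      have := hmin v' ⟨⟨hv', h1, h2, h3⟩, by
        rw [mem_ofPred_eq, ← hvr, hfv, hgv, mul_div_mul_left _ _ (by positivity)]⟩
      rw [hgv] at this
      nlinarith

/-- A visible point that is not a vertex lies on a non-radial edge. -/
lemma cross_ne_zero_of_clear (H : IsStarRegion V Adj I) {p q y : Plane} (hpq : Adj p q)
    (hy : y ∈ segment ℝ p q) (hcl : Clear Adj y) (hyV : y ∉ V) : cross y p ≠ 0 := by
  intro h
  have hy0 : y ≠ 0 := H.ne_zero_of_mem_bdry ⟨p, q, hpq, hy⟩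
  obtain ⟨a, ha⟩ := eq_smul_of_cross_eq_zero hy0 h
  obtain ⟨s, s0, s1, hs⟩ := mem_segment_iff.1 hy
  have hs0 : s ≠ 0 := by
    rintro rfl
    simp only [sub_zero, one_smul, zero_smul, add_zero] at hs
    exact hyV (hs ▸ H.left_mem hpq)
  have hs1 : s ≠ 1 := by
    rintro rfl
    simp only [sub_self, one_smul, zero_smul, zero_add] at hs
    exact hyV (hs ▸ H.right_mem hpq)
  have s0' : 0 < s := lt_of_le_of_ne s0 (Ne.symm hs0)
  have s1' : s < 1 := lt_of_le_of_ne s1 hs1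
  -- One of the endpoints is a multiple `b • y` with `b < 1`.
  obtain ⟨b, v, hb, hv, hvs⟩ : ∃ b : ℝ, ∃ v, b ≤ 1 ∧ v = b • y ∧ (v = p ∨ v = q) := by
    by_cases ha1 : a ≤ 1
    · exact ⟨a, p, ha1, ha, Or.inl rfl⟩
    · refine ⟨(1 - (1 - s) * a) / s, q, ?_, ?_, Or.inr rfl⟩
      · rw [div_le_one s0']; push Not at ha1; nlinarith
      · have : s • q = (1 - (1 - s) * a) • y := by
          have : s • q = y - (1 - s) • p := by
            conv_rhs => rw [hs]
            module
          rw [this, ha]; module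
        rw [div_eq_inv_mul, mul_smul, ← this, smul_smul, inv_mul_cancel₀ hs0, one_smul]
  have hvV : v ∈ V := by
    rcases hvs with rfl | rfl
    · exact H.left_mem hpq
    · exact H.right_mem hpq
  have hvseg : v ∈ segment ℝ p q := by
    rcases hvs with rfl | rfl
    · exact left_mem_segment ℝ _ _
    · exact right_mem_segment ℝ _ _
  rcases hb.lt_or_eq with hb | hb
  · by_cases hb0 : 0 ≤ b
    · exact hcl b hb0 hb (hv ▸ H.mem_bdry hvV)
    · push Not at hb0
      refine H.zero_notMem ⟨p, q, hpq, (convex_segment p q).segment_subset hvseg hy ?_⟩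
      refine mem_segment_iff.2 ⟨-b / (1 - b), div_nonneg (by linarith) (by linarith), ?_, ?_⟩
      · rw [div_le_one (by linarith)]; linarith
      · rw [hv, smul_smul, ← add_smul]
        have : (1 - -b / (1 - b)) * b + -b / (1 - b) = 0 := by
          have : (1 - b) ≠ 0 := by linarith
          field_simp; ring
        rw [this, zero_smul]
  · rw [hb, one_smul] at hv
    exact hyV (hv ▸ hvV)

/-- Every open half plane bounded by a line through the origin contains an exposed vertex. -/
lemma exists_exposed (H : IsStarRegion V Adj I) {φ : Plane →ₗ[ℝ] ℝ} {x : Plane} (hx : 0 < φ x) :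
    ∃ v ∈ exposed V Adj, 0 < φ v := by
  obtain ⟨t, t0, hb, hcl⟩ := H.exists_first_hit (x := x) (by rintro rfl; simp at hx)
  set y := t • x with hy
  have hφy : 0 < φ y := by rw [hy]; simp only [map_smul, smul_eq_mul]; positivity
  by_cases hyV : y ∈ V
  · exact ⟨y, ⟨hyV, hcl⟩, hφy⟩
  obtain ⟨p, q, hpq, hs, hφp⟩ : ∃ p q, Adj p q ∧ y ∈ segment ℝ p q ∧ 0 < φ p := by
    obtain ⟨c, d, hcd, hs⟩ := hb
    have := le_endpoint (-φ) hs
    simp only [LinearMap.neg_apply, neg_le_neg_iff] at this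
    rcases this with h | h
    · exact ⟨c, d, hcd, hs, by linarith⟩
    · exact ⟨d, c, H.symm hcd, by rwa [segment_symm], by linarith⟩
  obtain ⟨f, g, hd⟩ := exists_isDual (H.cross_ne_zero_of_clear hpq hs hcl hyV)
  by_contra! hno
  refine (H.clear_of_mem_edge hd hpq hs (left_mem_segment ℝ p q) hcl hyV ?_).1 (H.left_mem hpq)
  intro v hv hf hg
  have := hno v hv
  rw [hd.2.2.2.2 v] at this
  simp only [map_add, map_smul, smul_eq_mul] at this
  nlinarith [mul_nonneg hf hφy.le, mul_pos hg hφp]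

/-! ### A maximal cone of exposed vertices -/

/-- The closed convex cone spanned by two vectors. -/
def cone (a b : Plane) : Set Plane := {x | ∃ α β : ℝ, 0 ≤ α ∧ 0 ≤ β ∧ x = α • a + β • b}

/-- Two independent exposed vertices span a cone that is not contained in a larger cone of this
kind. For such a pair, the two quadrants adjacent to the cone contain no exposed vertex. -/
lemma exists_maximal_pair (H : IsStarRegion V Adj I) :
    ∃ a ∈ exposed V Adj, ∃ b ∈ exposed V Adj, cross a b ≠ 0 ∧
      ∀ f g, IsDual a b f g → ∀ v ∈ exposed V Adj, 0 ≤ f v * g v := by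
  set S : Set (Plane × Plane) :=
    {e | e.1 ∈ exposed V Adj ∧ e.2 ∈ exposed V Adj ∧ cross e.1 e.2 ≠ 0} with hS
  have hfin : S.Finite := (H.finite.prod H.finite).subset fun e he => ⟨he.1.1, he.2.1.1⟩
  have hne : S.Nonempty := by
    obtain ⟨v, hv, -⟩ := H.exists_exposed (φ := crossₗ (EuclideanSpace.single 0 1))
      (x := EuclideanSpace.single 1 1) (by simp [crossₗ, cross])
    have hv0 : v ≠ 0 := H.ne_zero_of_mem_bdry (H.mem_bdry hv.1)
    obtain ⟨x, hx⟩ : ∃ x, 0 < crossₗ v x := by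
      by_contra! h
      apply hv0
      have h1 := h (EuclideanSpace.single 1 1)
      have h2 := h (EuclideanSpace.single 1 (-1))
      have h3 := h (EuclideanSpace.single 0 1)
      have h4 := h (EuclideanSpace.single 0 (-1))
      simp [crossₗ, cross] at h1 h2 h3 h4
      ext i; fin_cases i <;> simp <;> linarith
    obtain ⟨w, hw, hvw⟩ := H.exists_exposed hx
    exact ⟨(v, w), hv, hw, hvw.ne'⟩
  obtain ⟨⟨a, b⟩, hab, hmax⟩ := hfin.exists_maximalFor (fun e => cone e.1 e.2) S hne
  have hsub : ∀ a b v, ∀ α β : ℝ, 0 < α → 0 < β → v = -α • a + β • b → cone a b ⊆ cone a v := by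
    rintro a b v α β hα hβ rfl x ⟨γ, δ, hγ, hδ, rfl⟩
    refine ⟨γ + δ * α / β, δ / β, by positivity, by positivity, ?_⟩
    rw [smul_add, smul_smul, smul_smul]
    have : δ / β * β = δ := by field_simp
    rw [this]
    module
  have hcomm : ∀ a b, cone a b = cone b a := by
    intro a b; ext x
    constructor <;> rintro ⟨α, β, h1, h2, rfl⟩ <;> exact ⟨β, α, h2, h1, add_comm _ _⟩
  refine ⟨a, hab.1, b, hab.2.1, hab.2.2, fun f g hd v hv => ?_⟩
  by_contra! hneg
  have hvd := hd.2.2.2.2 v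
  have hnot : v ∉ cone a b := by
    rintro ⟨α, β, h1, h2, h3⟩
    have e1 : f v = α := by rw [h3]; simp [hd.1, hd.2.1]
    have e2 : g v = β := by rw [h3]; simp [hd.2.2.1, hd.2.2.2.1]
    rw [e1, e2] at hneg; nlinarith
  rcases mul_neg_iff.1 hneg with ⟨h1, h2⟩ | ⟨h1, h2⟩
  · have hsub' : cone a b ⊆ cone v b := by
      rw [hcomm a b, hcomm v b]
      refine hsub b a v (-g v) (f v) (by linarith) h1 ?_
      rw [neg_neg, add_comm]; exact hvd
    have hmem : (v, b) ∈ S := by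
      refine ⟨hv, hab.2.1, ?_⟩
      rw [hd.cross_eq, hd.2.1, hd.2.2.2.1]
      simpa [h1.ne'] using hab.2.2
    exact hnot (hmax hmem hsub' ⟨1, 0, zero_le_one, le_rfl, by simp⟩)
  · have hsub' : cone a b ⊆ cone a v := by
      refine hsub a b v (-f v) (g v) (by linarith) h2 ?_
      rw [neg_neg]; exact hvd
    have hmem : (a, v) ∈ S := by
      refine ⟨hab.1, hv, ?_⟩
      rw [hd.cross_eq, hd.1, hd.2.2.1]
      simpa [h2.ne'] using hab.2.2
    exact hnot (hmax hmem hsub' ⟨0, 1, le_rfl, zero_le_one, by simp⟩)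

end IsStarRegion
end Starshaped

namespace Starshaped

/-! ### The lower hull of a finite set in a cone -/

/-- Two independent points `u`, `w` of `E` are consecutive on the part of the boundary of the convex
hull of `E` that faces the origin: no point of `E` is strictly on the side of the origin of the line
through `u` and `w`, and none lies strictly between them. -/
structure IsHullPair (E : Set Plane) (u w : Plane) : Prop where
  left_mem : u ∈ E
  right_mem : w ∈ E
  cross_ne : cross u w ≠ 0
  one_le : ∀ f g, IsDual u w f g → ∀ v ∈ E, 1 ≤ f v + g v
  notMem : ∀ v ∈ E, v ∉ openSegment ℝ u w

lemma IsDual.coord_eq {u w : Plane} {f g : Plane →ₗ[ℝ] ℝ} (h : IsDual u w f g)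
    (hc : cross u w ≠ 0) (x : Plane) : f x = cross x w / cross u w ∧ g x = cross u x / cross u w := by
  constructor
  · rw [h.cross_eq x w, h.2.1, h.2.2.2.1]; field_simp; ring
  · rw [h.cross_eq u x, h.1, h.2.2.1]; field_simp; ring

lemma coord_of_comb {u w m : Plane} (hc : cross u w ≠ 0) {α β : ℝ} (hm : m = α • u + β • w) :
    cross m w / cross u w = α ∧ cross u m / cross u w = β := by
  have h1 := cross_comb u w α β 0 1
  have h2 := cross_comb u w 1 0 α β
  simp only [zero_smul, one_smul, zero_add, add_zero, ← hm] at h1 h2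
  rw [h1, h2]
  constructor <;> field_simp <;> ring

/-- The ray of a vector `m` that is not parallel to any point of `E` passes between two consecutive
points of the lower hull: take the pair whose segment meets the ray as near to the origin as
possible, and of these the one that spans the smallest triangle with the origin. -/
lemma exists_hullPair_of_generic {E : Set Plane} (hE : E.Finite) {a b : Plane}
    {F G : Plane →ₗ[ℝ] ℝ} (hFG : IsDual a b F G) (hab : cross a b ≠ 0) (ha : a ∈ E) (hb : b ∈ E)
    (hE0 : (0 : Plane) ∉ E) (hEW : ∀ v ∈ E, 0 ≤ F v ∧ 0 ≤ G v) {m : Plane} (hF : 0 ≤ F m)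
    (hG : 0 ≤ G m) (hgen : ∀ v ∈ E, cross v m ≠ 0) :
    ∃ u w, IsHullPair E u w ∧ 0 ≤ cross m w / cross u w ∧ 0 ≤ cross u m / cross u w := by
  set S : Set (Plane × Plane) := {e | e.1 ∈ E ∧ e.2 ∈ E ∧ cross e.1 e.2 ≠ 0 ∧
    0 ≤ cross m e.2 / cross e.1 e.2 ∧ 0 ≤ cross e.1 m / cross e.1 e.2} with hS
  have hfin : S.Finite := (hE.prod hE).subset fun e he => ⟨he.1, he.2.1⟩
  have hmem : ∀ u ∈ E, ∀ w ∈ E, cross u w ≠ 0 → ∀ α β : ℝ, 0 ≤ α → 0 ≤ β → m = α • u + β • w →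
      (u, w) ∈ S := by
    intro u hu w hw hc α β hα hβ hm
    refine ⟨hu, hw, hc, ?_, ?_⟩
    · rw [(coord_of_comb hc hm).1]; exact hα
    · rw [(coord_of_comb hc hm).2]; exact hβ
  set N : Plane × Plane → ℝ := fun e => cross m e.2 / cross e.1 e.2 + cross e.1 m / cross e.1 e.2
    with hN
  have hNeq : ∀ u w, cross u w ≠ 0 → ∀ α β : ℝ, m = α • u + β • w → N (u, w) = α + β := by
    intro u w hc α β hm
    simp only [hN]
    rw [(coord_of_comb hc hm).1, (coord_of_comb hc hm).2]
  obtain ⟨e₀, he₀, hmax⟩ := Set.exists_max_image S N hfin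
    ⟨(a, b), hmem a ha b hb hab _ _ hF hG (hFG.2.2.2.2 m)⟩
  obtain ⟨⟨u, w⟩, ⟨⟨hu, hw, hc, hf0, hg0⟩, hNe⟩, hmin⟩ := Set.exists_min_image
    (S ∩ {e | N e = N e₀}) (fun e => |cross e.1 e.2|) (hfin.subset inter_subset_left)
    ⟨e₀, he₀, rfl⟩
  simp only [mem_ofPred_eq] at hu hw hc hf0 hg0 hNe hmin
  refine ⟨u, w, ⟨hu, hw, hc, ?_, ?_⟩, hf0, hg0⟩
  · intro f g hd v hv
    by_contra! hlt
    have hm := hd.2.2.2.2 m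
    have hvd := hd.2.2.2.2 v
    rw [← (hd.coord_eq hc m).1] at hf0
    rw [← (hd.coord_eq hc m).2] at hg0
    have hα : 0 < f m := by
      refine lt_of_le_of_ne hf0 (Ne.symm fun h => hgen w hw ?_)
      rw [hd.cross_eq, hd.2.1, h]; ring
    have hβ : 0 < g m := by
      refine lt_of_le_of_ne hg0 (Ne.symm fun h => hgen u hu ?_)
      rw [hd.cross_eq, hd.2.2.1, h]; ring
    have hpt : ¬ (f v ≤ 0 ∧ g v ≤ 0) := by
      rintro ⟨h1, h2⟩
      have hFv : F v = f v * F u + g v * F w := by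
        conv_lhs => rw [hvd]
        simp
      have hGv : G v = f v * G u + g v * G w := by
        conv_lhs => rw [hvd]
        simp
      have hF0 : F v = 0 := by
        nlinarith [(hEW v hv).1, (hEW u hu).1, (hEW w hw).1]
      have hG0 : G v = 0 := by
        nlinarith [(hEW v hv).2, (hEW u hu).2, (hEW w hw).2]
      have := hFG.2.2.2.2 v
      rw [hF0, hG0, zero_smul, zero_smul, add_zero] at this
      exact hE0 (this ▸ hv)
    have hNm : N (u, w) = f m + g m := hNeq u w hc _ _ hm
    -- Exchange `u` or `w` for `v`, so that the cone still contains `m`.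
    rcases le_total (f m * g v) (g m * f v) with h | h
    · have hγ : 0 < f v := by
        by_contra! h'
        have : 0 < g v := by
          by_contra! h''; exact hpt ⟨h', h''⟩
        nlinarith
      have hc' : cross v w ≠ 0 := by
        rw [hd.cross_eq, hd.2.1, hd.2.2.2.1]
        simpa [hγ.ne'] using hc
      have hm' : m = (f m / f v) • v + (g m - f m / f v * g v) • w := by
        calc m = f m • u + g m • w := hm
          _ = (f m / f v) • (f v • u + g v • w) + (g m - f m / f v * g v) • w := by
            have : f m = f m / f v * f v := by field_simp
            nth_rewrite 1 [this]; module
          _ = _ := by rw [← hvd]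
      have hnn : 0 ≤ g m - f m / f v * g v := by
        rw [div_mul_eq_mul_div, sub_nonneg, div_le_iff₀ hγ]; exact h
      have h3 := hmax (v, w) (hmem v hv w hw hc' _ _ (by positivity) hnn hm')
      rw [hNeq v w hc' _ _ hm', ← hNe, hNm] at h3
      have h4 : f m / f v * f v = f m := by field_simp
      have h5 : 0 < f m / f v := by positivity
      nlinarith
    · have hγ : 0 < g v := by
        by_contra! h'
        have : 0 < f v := by
          by_contra! h''; exact hpt ⟨h'', h'⟩
        nlinarith
      have hc' : cross u v ≠ 0 := by
        rw [hd.cross_eq, hd.1, hd.2.2.1]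
        simpa [hγ.ne'] using hc
      have hm' : m = (f m - g m / g v * f v) • u + (g m / g v) • v := by
        calc m = f m • u + g m • w := hm
          _ = (f m - g m / g v * f v) • u + (g m / g v) • (f v • u + g v • w) := by
            have : g m = g m / g v * g v := by field_simp
            nth_rewrite 1 [this]; module
          _ = _ := by rw [← hvd]
      have hnn : 0 ≤ f m - g m / g v * f v := by
        rw [div_mul_eq_mul_div, sub_nonneg, div_le_iff₀ hγ]; exact h
      have h3 := hmax (u, v) (hmem u hu v hv hc' _ _ hnn (by positivity) hm')
      rw [hNeq u v hc' _ _ hm', ← hNe, hNm] at h3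
      have h4 : g m / g v * g v = g m := by field_simp
      have h5 : 0 < g m / g v := by positivity
      nlinarith
  · intro v hv hvs
    obtain ⟨f, g, hd⟩ := exists_isDual hc
    obtain ⟨s, s0, s1, hs⟩ := mem_openSegment_iff.1 hvs
    have hm := hd.2.2.2.2 m
    rw [← (hd.coord_eq hc m).1] at hf0
    rw [← (hd.coord_eq hc m).2] at hg0
    have hNm : N (u, w) = f m + g m := hNeq u w hc _ _ hm
    have habs : 0 < |cross u w| := abs_pos.2 hc
    have hs1 : 0 < 1 - s := by linarith
    have hfv : f v = 1 - s := by rw [hs]; simp [hd.1, hd.2.1]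
    have hgv : g v = s := by rw [hs]; simp [hd.2.2.1, hd.2.2.2.1]
    rcases le_total (f m * s) (g m * (1 - s)) with h | h
    · have hcv : cross v w = (1 - s) * cross u w := by
        rw [hd.cross_eq, hd.2.1, hd.2.2.2.1, hfv]; ring
      have hc' : cross v w ≠ 0 := by rw [hcv]; exact mul_ne_zero hs1.ne' hc
      have hm' : m = (f m / (1 - s)) • v + (g m - f m / (1 - s) * s) • w := by
        have : f m = f m / (1 - s) * (1 - s) := by field_simp
        rw [hs]
        nth_rewrite 1 [hm, this]; module
      have hnn : 0 ≤ g m - f m / (1 - s) * s := by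
        rw [div_mul_eq_mul_div, sub_nonneg, div_le_iff₀ hs1]; exact h
      have h3 := hmin (v, w) ⟨hmem v hv w hw hc' _ _ (by positivity) hnn hm', by
        rw [mem_ofPred_eq, ← hNe, hNm, hNeq v w hc' _ _ hm']; field_simp; ring⟩
      simp only [hcv, abs_mul, abs_of_pos hs1] at h3
      nlinarith
    · have hcv : cross u v = s * cross u w := by
        rw [hd.cross_eq, hd.1, hd.2.2.1, hgv]; ring
      have hc' : cross u v ≠ 0 := by rw [hcv]; exact mul_ne_zero s0.ne' hc
      have hm' : m = (f m - g m / s * (1 - s)) • u + (g m / s) • v := by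
        have : g m = g m / s * s := by field_simp
        rw [hs]
        nth_rewrite 1 [hm, this]; module
      have hnn : 0 ≤ f m - g m / s * (1 - s) := by
        rw [div_mul_eq_mul_div, sub_nonneg, div_le_iff₀ s0]; exact h
      have h3 := hmin (u, v) ⟨hmem u hu v hv hc' _ _ hnn (by positivity) hm', by
        rw [mem_ofPred_eq, ← hNe, hNm, hNeq u v hc' _ _ hm']; field_simp; ring⟩
      simp only [hcv, abs_mul, abs_of_pos s0] at h3
      nlinarith

lemma continuous_cross_right (u : Plane) : Continuous (cross u) :=
  continuous_functional (crossₗ u)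

lemma continuous_cross_left (w : Plane) : Continuous fun x => cross x w := by
  simp only [cross_swap w]
  exact (continuous_cross_right w).neg

/-- Every direction of the cone lies in the cone of two consecutive points of the lower hull. Since
there are only finitely many pairs and their cones are closed, it suffices to consider generic
directions. -/
lemma exists_hullPair {E : Set Plane} (hE : E.Finite) {a b : Plane}
    {F G : Plane →ₗ[ℝ] ℝ} (hFG : IsDual a b F G) (hab : cross a b ≠ 0) (ha : a ∈ E) (hb : b ∈ E)
    (hE0 : (0 : Plane) ∉ E) (hEW : ∀ v ∈ E, 0 ≤ F v ∧ 0 ≤ G v) {m : Plane} (hm0 : m ≠ 0)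
    (hF : 0 ≤ F m) (hG : 0 ≤ G m) :
    ∃ u w, IsHullPair E u w ∧ 0 ≤ cross m w / cross u w ∧ 0 ≤ cross u m / cross u w := by
  obtain ⟨c, hcE, hmc⟩ : ∃ c ∈ E, cross m c ≠ 0 := by
    by_contra! h
    have h1 := h a ha
    have h2 := h b hb
    rw [hFG.cross_eq, hFG.1, hFG.2.2.1] at h1
    rw [hFG.cross_eq, hFG.2.1, hFG.2.2.2.1] at h2
    have e1 : G m = 0 := by
      have := (mul_eq_zero.1 h1).resolve_right hab; linarith
    have e2 : F m = 0 := by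
      have := (mul_eq_zero.1 h2).resolve_right hab; linarith
    apply hm0; rw [hFG.2.2.2.2 m, e1, e2]; simp
  set z : ℝ → Plane := fun t => m + t • c with hz
  have hzt : Tendsto z (𝓝[>] 0) (𝓝 m) := by
    have : Continuous z := by fun_prop
    have h := this.tendsto 0
    simp only [hz, zero_smul, add_zero] at h
    exact h.mono_left nhdsWithin_le_nhds
  -- The perturbed vector is parallel to `v` for at most one parameter.
  have hgen : ∀ᶠ t in 𝓝[>] (0 : ℝ), ∀ v ∈ E, cross v (z t) ≠ 0 := by
    rw [eventually_all_finite hE]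
    intro v hv
    have hv0 : v ≠ 0 := fun h => hE0 (h ▸ hv)
    by_cases h0 : cross v m = 0
    · have hvc : cross v c ≠ 0 := by
        intro h
        obtain ⟨t₁, h1⟩ := eq_smul_of_cross_eq_zero hv0 h0
        obtain ⟨t₂, h2⟩ := eq_smul_of_cross_eq_zero hv0 h
        apply hmc
        rw [h1, h2, cross_smul_right, cross_swap, cross_smul_right, cross_self]; ring
      filter_upwards [self_mem_nhdsWithin] with t ht
      rw [hz, cross_add_smul, h0, zero_add]
      exact mul_ne_zero (ne_of_gt ht) hvc
    · have : Tendsto (fun t => cross v (z t)) (𝓝[>] 0) (𝓝 (cross v m)) :=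
        ((continuous_cross_right v).tendsto m).comp hzt
      exact this.eventually_ne h0
  have hev : ∀ᶠ t in 𝓝[>] (0 : ℝ), ∃ e ∈ E ×ˢ E, IsHullPair E e.1 e.2 ∧
      0 ≤ cross (z t) e.2 / cross e.1 e.2 ∧ 0 ≤ cross e.1 (z t) / cross e.1 e.2 := by
    filter_upwards [hgen, self_mem_nhdsWithin] with t ht htpos
    have htpos' : 0 ≤ t := le_of_lt htpos
    obtain ⟨u, w, h1, h2, h3⟩ := exists_hullPair_of_generic hE hFG hab ha hb hE0 hEW
      (m := z t) (by
        simp only [hz, map_add, map_smul, smul_eq_mul]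
        have := (hEW c hcE).1; positivity) (by
        simp only [hz, map_add, map_smul, smul_eq_mul]
        have := (hEW c hcE).2; positivity) ht
    exact ⟨(u, w), ⟨h1.left_mem, h1.right_mem⟩, h1, h2, h3⟩
  obtain ⟨⟨u, w⟩, -, hfr⟩ : ∃ e ∈ E ×ˢ E, ∃ᶠ t in 𝓝[>] (0 : ℝ), IsHullPair E e.1 e.2 ∧
      0 ≤ cross (z t) e.2 / cross e.1 e.2 ∧ 0 ≤ cross e.1 (z t) / cross e.1 e.2 := by
    by_contra! h
    have h' := (eventually_all_finite (hE.prod hE)).2 h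
    obtain ⟨t, ⟨e, he, h1⟩, h2⟩ := (hev.and h').exists
    exact (h2 e he h1.1 h1.2.1).not_ge h1.2.2
  obtain ⟨t, ht, -⟩ := hfr.exists
  refine ⟨u, w, ht, ?_, ?_⟩
  · have hcl : IsClosed {x : Plane | 0 ≤ cross x w / cross u w} :=
      isClosed_le continuous_const ((continuous_cross_left w).div_const _)
    exact hcl.mem_of_frequently_of_tendsto (hfr.mono fun t ht => ht.2.1) hzt
  · have hcl : IsClosed {x : Plane | 0 ≤ cross u x / cross u w} :=
      isClosed_le continuous_const ((continuous_cross_right u).div_const _)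
    exact hcl.mem_of_frequently_of_tendsto (hfr.mono fun t ht => ht.2.2) hzt

end Starshaped

namespace Starshaped

/-! ### Guards spanned by the lower hull -/

lemma eventually_lt_along (f : Plane →ₗ[ℝ] ℝ) {y : Plane} (d : Plane) {r : ℝ} (h : r < f y) :
    ∀ᶠ ε in 𝓝[>] (0 : ℝ), r < f ((1 - ε) • y + ε • d) := by
  have hc : Continuous fun ε : ℝ => f ((1 - ε) • y + ε • d) :=
    (continuous_functional f).comp (by fun_prop)
  have ht := hc.tendsto 0
  simp only [sub_zero, one_smul, zero_smul, add_zero] at ht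
  exact (ht.mono_left nhdsWithin_le_nhds).eventually (eventually_gt_nhds h)

lemma eventually_gt_along (f : Plane →ₗ[ℝ] ℝ) {y : Plane} (d : Plane) {r : ℝ} (h : f y < r) :
    ∀ᶠ ε in 𝓝[>] (0 : ℝ), f ((1 - ε) • y + ε • d) < r := by
  filter_upwards [eventually_lt_along (-f) d (r := -r) (y := y) (by simpa using h)] with ε hε
  simp only [LinearMap.neg_apply] at hε
  linarith

lemma IsDual.coord_segment {u w : Plane} {f g : Plane →ₗ[ℝ] ℝ} (h : IsDual u w f g) (s : ℝ) :
    f ((1 - s) • u + s • w) = 1 - s ∧ g ((1 - s) • u + s • w) = s := by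
  simp [h.1, h.2.1, h.2.2.1, h.2.2.2.1]

lemma IsDual.mem_openSegment {u w z : Plane} {f g : Plane →ₗ[ℝ] ℝ} (h : IsDual u w f g)
    (hf : 0 < f z) (hg : 0 < g z) (h1 : f z + g z = 1) : z ∈ openSegment ℝ u w := by
  refine mem_openSegment_iff.2 ⟨g z, hg, by linarith, ?_⟩
  rw [show 1 - g z = f z by linarith]
  exact h.2.2.2.2 z

lemma IsDual.of_mem_openSegment {u w z : Plane} {f g : Plane →ₗ[ℝ] ℝ} (h : IsDual u w f g)
    (hz : z ∈ openSegment ℝ u w) : 0 < f z ∧ 0 < g z ∧ f z + g z = 1 := by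
  obtain ⟨s, s0, s1, rfl⟩ := mem_openSegment_iff.1 hz
  rw [(h.coord_segment s).1, (h.coord_segment s).2]
  exact ⟨by linarith, s0, by ring⟩

/-- Two open segments on a common line that meet: if the second has no endpoint in the first, then
it covers the first. -/
lemma mem_segment_of_collinear {u w c d y : Plane} {f g : Plane →ₗ[ℝ] ℝ} (hd : IsDual u w f g)
    (hc1 : f c + g c = 1) (hd1 : f d + g d = 1) (hy : y ∈ openSegment ℝ u w)
    (hy' : y ∈ openSegment ℝ c d) (hc : c ∉ openSegment ℝ u w) (hd' : d ∉ openSegment ℝ u w) :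
    u ∈ segment ℝ c d ∧ w ∈ segment ℝ c d := by
  have hout : ∀ z, f z + g z = 1 → z ∉ openSegment ℝ u w → g z ≤ 0 ∨ 1 ≤ g z := by
    intro z hz hzo
    by_contra! h
    exact hzo (hd.mem_openSegment (by linarith) h.1 hz)
  have hyc := hd.of_mem_openSegment hy
  have hpar : ∀ z, f z + g z = 1 → z = (1 - g z) • u + g z • w := by
    intro z hz
    rw [show 1 - g z = f z by linarith]; exact hd.2.2.2.2 z
  -- Both ends lie on the line through `c` and `d` at parameters between those of `c` and `d`.
  have key : ∀ c d : Plane, f c + g c = 1 → f d + g d = 1 → g c ≤ 0 → 1 ≤ g d →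
      u ∈ segment ℝ c d ∧ w ∈ segment ℝ c d := by
    intro c d hc1 hd1 h1 h2
    have hlt : 0 < g d - g c := by linarith
    have hmem : ∀ r : ℝ, 0 ≤ r → r ≤ 1 → (1 - r) • u + r • w ∈ segment ℝ c d := by
      intro r r0 r1
      refine mem_segment_iff.2 ⟨(r - g c) / (g d - g c), div_nonneg (by linarith) hlt.le, ?_, ?_⟩
      · rw [div_le_one hlt]; linarith
      · rw [hpar c hc1, hpar d hd1]
        simp only [map_add, map_smul, hd.2.2.1, hd.2.2.2.1, smul_eq_mul, mul_zero, mul_one,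
          zero_add]
        set k := (r - g c) / (g d - g c) with hk
        have : k * (g d - g c) = r - g c := by rw [hk]; field_simp
        have hr : r = (1 - k) * g c + k * g d := by linarith
        nth_rewrite 1 [hr]
        nth_rewrite 1 [hr]
        module
    constructor
    · simpa using hmem 0 le_rfl zero_le_one
    · simpa using hmem 1 zero_le_one le_rfl
  obtain ⟨s, s0, s1, hs⟩ := mem_openSegment_iff.1 hy'
  have hgy : g y = (1 - s) * g c + s * g d := by rw [hs, map_convex]
  rcases hout c hc1 hc with h1 | h1 <;> rcases hout d hd1 hd' with h2 | h2
  · exfalso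
    nlinarith [mul_nonneg s0.le (neg_nonneg.2 h2), mul_nonneg (sub_nonneg.2 s1.le) (neg_nonneg.2 h1),
      hyc.2.1]
  · exact key c d hc1 hd1 h1 h2
  · rw [segment_symm]; exact key d c hd1 hc1 h2 h1
  · exfalso
    nlinarith [mul_nonneg s0.le (sub_nonneg.2 h2), mul_nonneg (sub_nonneg.2 s1.le)
      (sub_nonneg.2 h1), hyc.1, hyc.2.2]

lemma IsHullPair.symm {E : Set Plane} {u w : Plane} (h : IsHullPair E u w) : IsHullPair E w u where
  left_mem := h.right_mem
  right_mem := h.left_mem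
  cross_ne := by rw [cross_swap]; exact neg_ne_zero.2 h.cross_ne
  one_le f g hd v hv := by rw [add_comm]; exact h.one_le g f hd.symm v hv
  notMem v hv := by rw [openSegment_symm]; exact h.notMem v hv

/-- Two exposed vertices `a`, `b` that span a cone, with coordinate functionals `F`, `G`, such that
the two quadrants adjacent to the cone contain no exposed vertex. -/
structure IsSector (V : Set Plane) (Adj : Plane → Plane → Prop) (a b : Plane)
    (F G : Plane →ₗ[ℝ] ℝ) : Prop where
  left_mem : a ∈ exposed V Adj
  right_mem : b ∈ exposed V Adj
  cross_ne : cross a b ≠ 0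
  isDual : IsDual a b F G
  quadrant : ∀ v ∈ exposed V Adj, 0 ≤ F v * G v

lemma IsSector.symm {V : Set Plane} {Adj : Plane → Plane → Prop} {a b : Plane}
    {F G : Plane →ₗ[ℝ] ℝ} (h : IsSector V Adj a b F G) : IsSector V Adj b a G F where
  left_mem := h.right_mem
  right_mem := h.left_mem
  cross_ne := by rw [cross_swap]; exact neg_ne_zero.2 h.cross_ne
  isDual := h.isDual.symm
  quadrant v hv := by rw [mul_comm]; exact h.quadrant v hv

/-- The exposed vertices in the cone where `F` and `G` are nonnegative. -/
def inCone (V : Set Plane) (Adj : Plane → Plane → Prop) (F G : Plane →ₗ[ℝ] ℝ) : Set Plane :=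
  {v | v ∈ exposed V Adj ∧ 0 ≤ F v ∧ 0 ≤ G v}

lemma inCone_comm (V : Set Plane) (Adj : Plane → Plane → Prop) (F G : Plane →ₗ[ℝ] ℝ) :
    inCone V Adj F G = inCone V Adj G F := by
  ext v; exact and_congr_right fun _ => and_comm

namespace IsStarRegion

variable {V : Set Plane} {Adj : Plane → Plane → Prop} {I : Set Plane} {F G : Plane →ₗ[ℝ] ℝ}
  {u w : Plane} {f g : Plane →ₗ[ℝ] ℝ}

/-- The triangle spanned by the origin and a hull pair belongs to the region, up to its side
opposite to the origin. -/
lemma mem_of_hullPair (H : IsStarRegion V Adj I) (hp : IsHullPair (inCone V Adj F G) u w)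
    (hd : IsDual u w f g) {x : Plane} (hf : 0 ≤ f x) (hg : 0 ≤ g x) (h1 : f x + g x < 1) :
    x ∈ I := by
  refine H.mem_of_lt_one hd hp.left_mem.1.2 hp.right_mem.1.2 (fun v hv hfv hgv => ?_) hf hg h1
  refine hp.one_le f g hd v ⟨hv, ?_, ?_⟩
  · rw [hd.2.2.2.2 v]
    simp only [map_add, map_smul, smul_eq_mul]
    have := hp.left_mem.2.1; have := hp.right_mem.2.1; positivity
  · rw [hd.2.2.2.2 v]
    simp only [map_add, map_smul, smul_eq_mul]
    have := hp.left_mem.2.2; have := hp.right_mem.2.2; positivity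

/-- The open segment of a hull pair is an edge or runs inside the region. -/
lemma adj_or_subset_of_hullPair (H : IsStarRegion V Adj I)
    (hp : IsHullPair (inCone V Adj F G) u w) : Adj u w ∨ openSegment ℝ u w ⊆ I := by
  obtain ⟨f, g, hd⟩ := exists_isDual hp.cross_ne
  have hnotV : ∀ y ∈ openSegment ℝ u w, y ∉ V := by
    intro y hy hyV
    have hyc := hd.of_mem_openSegment hy
    refine hp.notMem y ⟨⟨hyV, fun t t0 t1 => H.notMem_bdry (H.mem_of_hullPair hp hd ?_ ?_ ?_)⟩,
      ?_, ?_⟩ hy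
    · simp only [map_smul, smul_eq_mul]; exact mul_nonneg t0 hyc.1.le
    · simp only [map_smul, smul_eq_mul]; exact mul_nonneg t0 hyc.2.1.le
    · simp only [map_smul, smul_eq_mul]; rw [← mul_add, hyc.2.2]; linarith
    · rw [hd.2.2.2.2 y]
      simp only [map_add, map_smul, smul_eq_mul]
      have := hp.left_mem.2.1; have := hp.right_mem.2.1
      have := hyc.1; have := hyc.2.1; positivity
    · rw [hd.2.2.2.2 y]
      simp only [map_add, map_smul, smul_eq_mul]
      have := hp.left_mem.2.2; have := hp.right_mem.2.2
      have := hyc.1; have := hyc.2.1; positivity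
  by_cases hex : ∃ y ∈ openSegment ℝ u w, y ∈ bdry Adj
  swap
  · right
    intro y hy
    have hyc := hd.of_mem_openSegment hy
    refine H.mem_iff.2 fun t t0 t1 => ?_
    rcases t1.lt_or_eq with t1 | rfl
    · refine H.notMem_bdry (H.mem_of_hullPair hp hd ?_ ?_ ?_)
      · simp only [map_smul, smul_eq_mul]; exact mul_nonneg t0 hyc.1.le
      · simp only [map_smul, smul_eq_mul]; exact mul_nonneg t0 hyc.2.1.le
      · simp only [map_smul, smul_eq_mul]; rw [← mul_add, hyc.2.2]; linarith
    · rw [one_smul]; exact fun h => hex ⟨y, hy, h⟩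
  left
  obtain ⟨y, hy, c, d, hcd, hys⟩ := hex
  have hyc := hd.of_mem_openSegment hy
  -- The edge through `y` does not enter the triangle, so that it runs along `u w`.
  have hge : ∀ c d, Adj c d → y ∈ segment ℝ c d → 1 ≤ f d + g d := by
    intro c d hcd hys
    by_contra! hlt
    obtain ⟨ε, ⟨⟨h1, h2⟩, h3⟩, h4⟩ := (((eventually_lt_along f d hyc.1).and
      (eventually_lt_along g d hyc.2.1)).and (eventually_lt_nhds one_pos |>.filter_mono
        nhdsWithin_le_nhds)).and self_mem_nhdsWithin |>.exists
    have h4' : (0 : ℝ) < ε := h4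
    refine H.notMem_bdry (H.mem_of_hullPair hp hd h1.le h2.le ?_) ⟨c, d, hcd,
      (convex_segment c d).segment_subset hys (right_mem_segment ℝ c d)
        (mem_segment_iff.2 ⟨ε, h4'.le, h3.le, rfl⟩)⟩
    simp only [map_convex]
    nlinarith [hyc.2.2]
  have hd1 := hge c d hcd hys
  have hc1 := hge d c (H.symm hcd) (by rwa [segment_symm])
  have hyo : y ∈ openSegment ℝ c d := by
    refine mem_openSegment_of_ne_left_right ?_ ?_ hys
    · rintro rfl; exact hnotV _ hy (H.left_mem hcd)
    · rintro rfl; exact hnotV _ hy (H.right_mem hcd)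
  obtain ⟨s, s0, s1, hs⟩ := mem_openSegment_iff.1 hyo
  have hsum : (1 - s) * (f c + g c) + s * (f d + g d) = 1 := by
    have := hyc.2.2
    rw [hs] at this; simp only [map_convex] at this; linarith
  have hc1' : f c + g c = 1 := by
    nlinarith [mul_nonneg s0.le (sub_nonneg.2 hd1), sub_pos.2 s1]
  have hd1' : f d + g d = 1 := by
    nlinarith [mul_nonneg (sub_pos.2 s1).le (sub_nonneg.2 hc1), s0]
  obtain ⟨hu, hw⟩ := mem_segment_of_collinear hd hc1' hd1' hy hyo
    (fun h => hnotV c h (H.left_mem hcd)) (fun h => hnotV d h (H.right_mem hcd))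
  have hne : u ≠ w := by
    rintro rfl; exact hp.cross_ne (cross_self u)
  rcases H.vertex_on_edge hp.left_mem.1.1 hcd hu with h1 | h1 <;>
    rcases H.vertex_on_edge hp.right_mem.1.1 hcd hw with h2 | h2
  · exact absurd (h1.trans h2.symm) hne
  · rw [h1, h2]; exact hcd
  · rw [h1, h2]; exact H.symm hcd
  · exact absurd (h1.trans h2.symm) hne

/-- Points of two different hull segments do not see each other: the segment between them crosses
the ray of an endpoint of the first one at or beyond this endpoint. -/
lemma not_subset_of_hullPair (H : IsStarRegion V Adj I) {u' w' p q : Plane}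
    (hp : IsHullPair (inCone V Adj F G) u w) (hp' : IsHullPair (inCone V Adj F G) u' w')
    (hne : openSegment ℝ u w ≠ openSegment ℝ u' w') (hpm : p ∈ openSegment ℝ u w)
    (hqm : q ∈ openSegment ℝ u' w') : p ≠ q ∧ ¬ openSegment ℝ p q ⊆ I := by
  obtain ⟨f', g', hd'⟩ := exists_isDual hp'.cross_ne
  have hq' := hd'.of_mem_openSegment hqm
  -- If the second segment leaves the cone of the first one through the ray of `u`.
  have key : ∀ u w f g, IsHullPair (inCone V Adj F G) u w → IsDual u w f g →
      p ∈ openSegment ℝ u w → g q ≤ 0 → p ≠ q ∧ ¬ openSegment ℝ p q ⊆ I := by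
    intro u w f g hp hd hpm hg
    have hpc := hd.of_mem_openSegment hpm
    have hpq : p ≠ q := by rintro rfl; linarith [hpc.2.1]
    refine ⟨hpq, fun hsub => ?_⟩
    have hLq : 1 ≤ f q + g q := by
      obtain ⟨s, s0, s1, hs⟩ := mem_openSegment_iff.1 hqm
      have h1 := hp.one_le f g hd u' hp'.left_mem
      have h2 := hp.one_le f g hd w' hp'.right_mem
      rw [hs]; simp only [map_convex]
      nlinarith [mul_nonneg s0.le (sub_nonneg.2 h2),
        mul_nonneg (sub_pos.2 s1).le (sub_nonneg.2 h1)]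
    obtain ⟨s, s0, s1, hs⟩ := exists_zero_on_segment (continuous_functional g) hpc.2.1.le hg
    set z := (1 - s) • p + s • q with hz
    have hLz : 1 ≤ f z := by
      have : 1 ≤ f z + g z := by
        rw [hz]; simp only [map_convex]; nlinarith [hpc.2.2]
      linarith
    have hzu : z = f z • u := by
      conv_lhs => rw [hd.2.2.2.2 z, hs, zero_smul, add_zero]
    have hzI : z ∉ I := by
      rw [hzu]; exact H.smul_notMem (H.mem_bdry hp.left_mem.1.1) hLz
    have s0' : 0 < s := by
      refine lt_of_le_of_ne s0 ?_
      rintro rfl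
      rw [hz] at hs
      simp only [sub_zero, one_smul, zero_smul, add_zero] at hs
      linarith [hpc.2.1]
    rcases s1.lt_or_eq with s1 | rfl
    · exact hzI (hsub (mem_openSegment_iff.2 ⟨s, s0', s1, hz⟩))
    · have hzq : z = q := by rw [hz]; simp
      rw [hzq] at hzu hLz
      have h1 := hp'.one_le f' g' hd' u hp.left_mem
      have h2 : f' q + g' q = f q * (f' u + g' u) := by
        conv_lhs => rw [hzu]
        simp only [map_smul, smul_eq_mul]; ring
      have h3 : f q = 1 := by nlinarith [hq'.2.2]
      rw [h3, one_smul] at hzu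
      exact hp'.notMem u hp.left_mem (hzu ▸ hqm)
  obtain ⟨f, g, hd⟩ := exists_isDual hp.cross_ne
  rcases le_or_gt (g q) 0 with hg | hg
  · exact key u w f g hp hd hpm hg
  rcases le_or_gt (f q) 0 with hf | hf
  · exact key w u g f hp.symm hd.symm (by rwa [openSegment_symm]) hf
  -- Otherwise the two segments meet, and then they agree.
  exfalso
  apply hne
  obtain ⟨s, s0, s1, hs⟩ := mem_openSegment_iff.1 hqm
  have h1 := hp.one_le f g hd u' hp'.left_mem
  have h2 := hp.one_le f g hd w' hp'.right_mem
  have hsum : f q + g q = (1 - s) * (f u' + g u') + s * (f w' + g w') := by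
    rw [hs]; simp only [map_convex]; ring
  have hle : f q + g q ≤ 1 := by
    have h3 := hp'.one_le f' g' hd' u hp.left_mem
    have h4 := hp'.one_le f' g' hd' w hp.right_mem
    have h5 : f' q + g' q = f q * (f' u + g' u) + g q * (f' w + g' w) := by
      conv_lhs => rw [hd.2.2.2.2 q]
      simp only [map_add, map_smul, smul_eq_mul]; ring
    nlinarith [hq'.2.2, mul_nonneg hf.le (sub_nonneg.2 h3), mul_nonneg hg.le (sub_nonneg.2 h4)]
  have hu1 : f u' + g u' = 1 := by
    nlinarith [mul_nonneg s0.le (sub_nonneg.2 h2), sub_pos.2 s1]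
  have hw1 : f w' + g w' = 1 := by
    nlinarith [mul_nonneg (sub_pos.2 s1).le (sub_nonneg.2 h1), s0]
  have hq1 : f q + g q = 1 := by rw [hsum, hu1, hw1]; ring
  obtain ⟨hu, hw⟩ := mem_segment_of_collinear hd hu1 hw1 (hd.mem_openSegment hf hg hq1) hqm
    (hp.notMem u' hp'.left_mem) (hp.notMem w' hp'.right_mem)
  have hend : ∀ z ∈ inCone V Adj F G, z ∈ segment ℝ u' w' → z = u' ∨ z = w' := by
    intro z hz hzs
    by_contra! h
    exact hp'.notMem z hz (mem_openSegment_of_ne_left_right h.1.symm h.2.symm hzs)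
  have huw : u ≠ w := by
    rintro rfl; exact hp.cross_ne (cross_self u)
  rcases hend u hp.left_mem hu with e1 | e1 <;> rcases hend w hp.right_mem hw with e2 | e2
  · exact absurd (e1.trans e2.symm) huw
  · rw [e1, e2]
  · rw [e1, e2, openSegment_symm]
  · exact absurd (e1.trans e2.symm) huw

/-- A hull segment is entirely visible from each point of its triangle. -/
lemma openSegment_subset_of_lt_one (H : IsStarRegion V Adj I)
    (hp : IsHullPair (inCone V Adj F G) u w) (hd : IsDual u w f g) {l p : Plane}
    (hf : 0 ≤ f l) (hg : 0 ≤ g l) (h1 : f l + g l < 1) (hpm : p ∈ openSegment ℝ u w) :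
    openSegment ℝ l p ⊆ I := by
  intro z hz
  have hpc := hd.of_mem_openSegment hpm
  obtain ⟨s, s0, s1, rfl⟩ := mem_openSegment_iff.1 hz
  have s1' := sub_pos.2 s1
  have := hpc.1
  have := hpc.2.1
  refine H.mem_of_hullPair hp hd ?_ ?_ ?_ <;> simp only [map_convex]
  · positivity
  · positivity
  · nlinarith [hpc.2.2]

lemma nonempty_openSegment (u w : Plane) : ∃ p, p ∈ openSegment ℝ u w :=
  ⟨_, mem_openSegment_iff.2 ⟨1 / 2, by norm_num, by norm_num, rfl⟩⟩

/-- A hull segment sees every point of the region in its cone. -/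
lemma exists_sees_of_mem_cone (H : IsStarRegion V Adj I)
    (hp : IsHullPair (inCone V Adj F G) u w) (hd : IsDual u w f g) {l : Plane} (hl : l ∈ I)
    (hf : 0 ≤ f l) (hg : 0 ≤ g l) : ∃ p ∈ openSegment ℝ u w, openSegment ℝ l p ⊆ I := by
  rcases lt_or_ge (f l + g l) 1 with hlt | hge
  · obtain ⟨p, hpm⟩ := nonempty_openSegment u w
    exact ⟨p, hpm, H.openSegment_subset_of_lt_one hp hd hf hg hlt hpm⟩
  · have hld := hd.2.2.2.2 l
    have hf' : 0 < f l := by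
      refine lt_of_le_of_ne hf fun h => ?_
      rw [← h, zero_smul, zero_add] at hld
      exact H.smul_notMem (H.mem_bdry hp.right_mem.1.1) (by linarith) (hld ▸ hl)
    have hg' : 0 < g l := by
      refine lt_of_le_of_ne hg fun h => ?_
      rw [← h, zero_smul, add_zero] at hld
      exact H.smul_notMem (H.mem_bdry hp.left_mem.1.1) (by linarith) (hld ▸ hl)
    have hpos : 0 < f l + g l := by linarith
    refine ⟨(f l + g l)⁻¹ • l, hd.mem_openSegment ?_ ?_ ?_, fun z hz => ?_⟩
    · simp only [map_smul, smul_eq_mul]; positivity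
    · simp only [map_smul, smul_eq_mul]; positivity
    · simp only [map_smul, smul_eq_mul]; field_simp
    · obtain ⟨s, s0, s1, rfl⟩ := mem_openSegment_iff.1 hz
      rw [smul_smul, ← add_smul]
      have h1 : (f l + g l)⁻¹ ≤ 1 := inv_le_one_of_one_le₀ hge
      have h0 : 0 < (f l + g l)⁻¹ := by positivity
      have s1' := sub_pos.2 s1
      exact H.smul_mem hl (by positivity) (by nlinarith)

/-- A hull segment sees every point `l` of the region on the ray opposite to one of its
endpoints. The view towards the endpoint itself is perturbed into the segment: as long as the sight
line is away from the endpoint, it stays in the region by compactness, and later it is in the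
triangle of the hull segment. -/
lemma exists_sees_of_opposite_endpoint (H : IsStarRegion V Adj I)
    (hp : IsHullPair (inCone V Adj F G) u w) (hd : IsDual u w f g) {l : Plane} (hl : l ∈ I)
    (hf : f l < 0) (hg : g l = 0) : ∃ p ∈ openSegment ℝ u w, openSegment ℝ l p ⊆ I := by
  set α := -f l with hα
  have hα0 : 0 < α := by rw [hα]; linarith
  have hlu : l = -α • u := by
    conv_lhs => rw [hd.2.2.2.2 l, hg, zero_smul, add_zero]
    rw [hα, neg_neg]
  set s₀ := (1 / 2 + α) / (1 + α) with hs₀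
  have hs₀e : s₀ * (1 + α) = 1 / 2 + α := by rw [hs₀]; field_simp
  have hs₀0 : 0 < s₀ := by positivity
  have hcont : Continuous fun e : ℝ × ℝ =>
      (1 - e.2) • l + e.2 • ((1 - e.1) • u + e.1 • w) := by fun_prop
  have hev : ∀ᶠ ε in 𝓝 (0 : ℝ), ∀ s ∈ Icc 0 s₀,
      (1 - s) • l + s • ((1 - ε) • u + ε • w) ∈ I := by
    refine isCompact_Icc.eventually_forall_of_forall_eventually fun s hs => ?_
    refine hcont.continuousAt.eventually (H.isOpen.mem_nhds ?_)
    simp only [sub_zero, one_smul, zero_smul, add_zero]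
    have hval : (1 - s) • l + s • u = (s - α * (1 - s)) • u := by rw [hlu]; module
    have hs1 : s * (1 + α) ≤ 1 / 2 + α := by
      rw [← hs₀e]; exact mul_le_mul_of_nonneg_right hs.2 (by positivity)
    by_cases hc : 0 ≤ s - α * (1 - s)
    · rw [hval]
      exact H.smul_mem_of_clear hp.left_mem.1.2 hc (by nlinarith)
    · have : (1 - s) • l + s • u = ((α * (1 - s) - s) / α) • l := by
        rw [hval, hlu, smul_smul]
        congr 1; field_simp; ring
      rw [this]
      push Not at hc
      refine H.smul_mem hl (div_nonneg (by linarith) hα0.le) ?_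
      rw [div_le_one hα0]; nlinarith [hs.1]
  obtain ⟨ε, ⟨h1, h2⟩, h3⟩ := ((hev.filter_mono nhdsWithin_le_nhds).and
    ((eventually_lt_nhds (show (0 : ℝ) < 1 / 2 by norm_num)).filter_mono
      nhdsWithin_le_nhds)).and (self_mem_nhdsWithin (s := Ioi (0 : ℝ))) |>.exists
  have h3' : 0 < ε := h3
  refine ⟨(1 - ε) • u + ε • w, mem_openSegment_iff.2 ⟨ε, h3', by linarith, rfl⟩,
    fun z hz => ?_⟩
  obtain ⟨s, s0, s1, rfl⟩ := mem_openSegment_iff.1 hz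
  rcases le_or_gt s s₀ with hs | hs
  · exact h1 s ⟨s0.le, hs⟩
  · have hs' : 1 / 2 + α < s * (1 + α) := by
      rw [← hs₀e]; exact mul_lt_mul_of_pos_right hs (by positivity)
    have hfl : f l = -α := by rw [hα, neg_neg]
    refine H.mem_of_hullPair hp hd ?_ ?_ ?_ <;>
      simp only [map_convex f l, map_convex g l, (hd.coord_segment ε).1,
        (hd.coord_segment ε).2, hg, hfl]
    · nlinarith
    · nlinarith
    · nlinarith

/-- A hull segment sees every point of the region in the cone opposite to its own: the sight line
passes through the origin. -/
lemma exists_sees_of_mem_neg_cone (H : IsStarRegion V Adj I)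
    (hp : IsHullPair (inCone V Adj F G) u w) (hd : IsDual u w f g) {l : Plane} (hl : l ∈ I)
    (hf : f l ≤ 0) (hg : g l ≤ 0) : ∃ p ∈ openSegment ℝ u w, openSegment ℝ l p ⊆ I := by
  rcases hf.lt_or_eq with hf | hf
  swap
  · rcases hg.lt_or_eq with hg | hg
    · obtain ⟨p, h1, h2⟩ := H.exists_sees_of_opposite_endpoint hp.symm hd.symm hl hg hf
      exact ⟨p, by rwa [openSegment_symm], h2⟩
    · exact H.exists_sees_of_mem_cone hp hd hl hf.ge hg.ge
  rcases hg.lt_or_eq with hg | hg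
  swap
  · exact H.exists_sees_of_opposite_endpoint hp hd hl hf hg
  set L := -(f l + g l) with hL
  have hL0 : 0 < L := by rw [hL]; linarith
  refine ⟨(-L⁻¹) • l, hd.mem_openSegment ?_ ?_ ?_, fun z hz => ?_⟩
  · simp only [map_smul, smul_eq_mul]
    have : 0 < L⁻¹ := by positivity
    nlinarith
  · simp only [map_smul, smul_eq_mul]
    have : 0 < L⁻¹ := by positivity
    nlinarith
  · simp only [map_smul, smul_eq_mul]
    have : L⁻¹ * L = 1 := by field_simp
    rw [hL] at this ⊢; linarith
  · obtain ⟨s, s0, s1, rfl⟩ := mem_openSegment_iff.1 hz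
    rw [smul_smul, ← add_smul]
    have h0 : 0 < L⁻¹ := by positivity
    have h1 : L⁻¹ * L = 1 := by field_simp
    set c := 1 - s + s * -L⁻¹ with hc
    have hcL : c * L = (1 - s) * L - s := by
      rw [hc]; linear_combination -s * h1
    rcases le_or_gt 0 c with h | h
    · exact H.smul_mem hl h (by nlinarith)
    · refine H.mem_of_hullPair hp hd ?_ ?_ ?_ <;> simp only [map_smul, smul_eq_mul]
      · nlinarith
      · nlinarith
      · have : c * f l + c * g l = -(c * L) := by rw [hL]; ring
        rw [this, hcL]
        nlinarith [mul_pos (sub_pos.2 s1) hL0]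

end IsStarRegion
end Starshaped

namespace Starshaped
namespace IsStarRegion

variable {V : Set Plane} {Adj : Plane → Plane → Prop} {I : Set Plane} {a b : Plane}
  {F G : Plane →ₗ[ℝ] ℝ}

/-! ### The quadrants adjacent to the cone -/

/-- In a quadrant without exposed vertices, the region is bounded by a single edge, which runs from
a point of the ray of `b` to a point of the ray opposite to `a`. -/
lemma exists_edge_across (H : IsStarRegion V Adj I) (hS : IsSector V Adj a b F G) :
    ∃ c d, Adj c d ∧ ∃ τ μ : ℝ, 0 < τ ∧ 0 < μ ∧ τ • b ∈ segment ℝ c d ∧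
      ∀ x, F x < 0 → 0 < G x → (x ∈ I ↔ -F x / μ + G x / τ < 1) := by
  have hd := hS.isDual
  have hquad : ∀ v ∈ exposed V Adj, F v < 0 → ¬ 0 < G v := fun v hv h1 h2 => by
    have := hS.quadrant v hv; nlinarith
  obtain ⟨t, t0, hyb, hyc⟩ := H.exists_first_hit (x := b - a) (by
    intro h
    have : F (b - a) = 0 := by rw [h, map_zero]
    rw [map_sub, hd.1, hd.2.1] at this; norm_num at this)
  set y := t • (b - a) with hy
  have hFy : F y < 0 := by rw [hy]; simp [hd.1, hd.2.1, t0]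
  have hGy : 0 < G y := by rw [hy]; simp [hd.2.2.1, hd.2.2.2.1, t0]
  have hyV : y ∉ V := fun h => hquad y ⟨h, hyc⟩ hFy hGy
  obtain ⟨c, d, hcd, hys⟩ := hyb
  -- All points of the edge of `y` in the quadrant are visible and no vertices.
  have hedge : ∀ p q, Adj p q → y ∈ segment ℝ p q → ∀ y' ∈ segment ℝ p q, F y' < 0 → 0 < G y' →
      y' ∉ V ∧ Clear Adj y' := by
    intro p q hpq hys y' hy's hF' hG'
    by_cases hcr : cross y y' = 0
    · have hyp := H.cross_ne_zero_of_clear hpq hys hyc hyV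
      obtain ⟨s, s0, s1, hs⟩ := mem_segment_iff.1 hys
      obtain ⟨s', s0', s1', hs'⟩ := mem_segment_iff.1 hy's
      have e1 : (1 - s) * cross y p + s * cross y q = 0 := by
        rw [← cross_self y]
        conv_rhs => arg 2; rw [hs]
        exact (map_convex (crossₗ y) p q s).symm
      have e2 : (1 - s') * cross y p + s' * cross y q = 0 := by
        rw [← hcr]
        conv_rhs => arg 2; rw [hs']
        exact (map_convex (crossₗ y) p q s').symm
      have e3 : (s - s') * (cross y q - cross y p) = 0 := by linear_combination e1 - e2
      rcases mul_eq_zero.1 e3 with h | h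
      · have : s = s' := by linarith
        have hyy : y' = y := by rw [hs', hs, this]
        rw [hyy]; exact ⟨hyV, hyc⟩
      · exfalso; apply hyp; nlinarith
    · obtain ⟨f, g, hd'⟩ := exists_isDual hcr
      refine H.clear_of_mem_edge hd' hpq hys hy's hyc hyV fun v hv hf hg => ?_
      refine hquad v hv ?_ ?_
      · rw [hd'.2.2.2.2 v]; simp only [map_add, map_smul, smul_eq_mul]; nlinarith
      · rw [hd'.2.2.2.2 v]; simp only [map_add, map_smul, smul_eq_mul]; nlinarith
  obtain ⟨p, q, hpq, hys, hFp⟩ : ∃ p q, Adj p q ∧ y ∈ segment ℝ p q ∧ 0 ≤ F p := by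
    by_cases h1 : 0 ≤ F c
    · exact ⟨c, d, hcd, hys, h1⟩
    by_cases h2 : 0 ≤ F d
    · exact ⟨d, c, H.symm hcd, by rwa [segment_symm], h2⟩
    exfalso
    push Not at h1 h2
    have h3 : ¬ 0 < G c := fun h =>
      (hedge c d hcd hys c (left_mem_segment ℝ c d) h1 h).1 (H.left_mem hcd)
    have h4 : ¬ 0 < G d := fun h =>
      (hedge c d hcd hys d (right_mem_segment ℝ c d) h2 h).1 (H.right_mem hcd)
    have := le_endpoint (-G) hys
    simp only [LinearMap.neg_apply] at this
    rcases this with h | h <;> linarith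
  obtain ⟨s, s0, s1, hs⟩ := mem_segment_iff.1 hys
  have hFy' : F y = (1 - s) * F p + s * F q := by rw [← map_convex, ← hs]
  have hGy' : G y = (1 - s) * G p + s * G q := by rw [← map_convex, ← hs]
  have hFq : F q < 0 := by
    by_contra! h
    nlinarith [mul_nonneg (sub_nonneg.2 s1) hFp, mul_nonneg s0 h]
  have hGq : G q ≤ 0 := by
    by_contra! h
    exact (hedge p q hpq hys q (right_mem_segment ℝ p q) hFq h).1 (H.right_mem hpq)
  have hGp : 0 < G p := by
    by_contra! h
    nlinarith [mul_nonneg (sub_nonneg.2 s1) (neg_nonneg.2 h), mul_nonneg s0 (neg_nonneg.2 hGq)]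
  obtain ⟨r₁, r₁0, r₁1, hr₁⟩ := exists_zero_on_segment (continuous_functional F) hFp hFy.le
  obtain ⟨r₂, r₂0, r₂1, hr₂⟩ := exists_zero_on_segment (continuous_functional G) hGy.le hGq
  set z₁ := (1 - r₁) • p + r₁ • y with hz₁
  set z₂ := (1 - r₂) • y + r₂ • q with hz₂
  have hz₁s : z₁ ∈ segment ℝ p q := (convex_segment p q).segment_subset (left_mem_segment ℝ p q) hys
    (mem_segment_iff.2 ⟨r₁, r₁0, r₁1, hz₁⟩)
  have hz₂s : z₂ ∈ segment ℝ p q := (convex_segment p q).segment_subset hys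
    (right_mem_segment ℝ p q) (mem_segment_iff.2 ⟨r₂, r₂0, r₂1, hz₂⟩)
  have hτ : 0 < G z₁ := by
    rw [hz₁, map_convex]
    rcases r₁0.lt_or_eq with h | h
    · nlinarith [mul_nonneg (sub_nonneg.2 r₁1) hGp.le, mul_pos h hGy]
    · rw [← h]; linarith
  have hμ : 0 < -F z₂ := by
    rw [hz₂, map_convex]
    rcases r₂0.lt_or_eq with h | h
    · nlinarith [mul_nonneg (sub_nonneg.2 r₂1) (neg_pos.2 hFy).le, mul_pos h (neg_pos.2 hFq)]
    · rw [← h]; linarith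
  have e1 : z₁ = G z₁ • b := by
    conv_lhs => rw [hd.2.2.2.2 z₁, hr₁, zero_smul, zero_add]
  have e2 : z₂ = F z₂ • a := by
    conv_lhs => rw [hd.2.2.2.2 z₂, hr₂, zero_smul, add_zero]
  refine ⟨p, q, hpq, G z₁, -F z₂, hτ, hμ, e1 ▸ hz₁s, fun x hF hG => ?_⟩
  set N := -F x / -F z₂ + G x / G z₁ with hN
  have hN1 : 0 < -F x / -F z₂ := div_pos (by linarith) hμ
  have hN2 : 0 < G x / G z₁ := div_pos hG hτ
  have hN0 : 0 < N := by positivity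
  -- The point of the edge on the ray of `x`.
  have hmem : N⁻¹ • x ∈ segment ℝ p q := by
    refine (convex_segment p q).segment_subset hz₂s hz₁s ?_
    refine mem_segment_iff.2 ⟨N⁻¹ * (G x / G z₁), by positivity, ?_, ?_⟩
    · rw [inv_mul_le_iff₀ hN0]; linarith
    · have h1 : 1 - N⁻¹ * (G x / G z₁) = N⁻¹ * (-F x / -F z₂) := by
        have : N⁻¹ * N = 1 := by field_simp
        rw [hN] at this ⊢; linear_combination -this
      rw [h1, mul_smul, mul_smul, ← smul_add]
      congr 1
      conv_lhs => rw [hd.2.2.2.2 x]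
      conv_rhs => rw [e1, e2]
      simp only [map_smul, hd.1, hd.2.2.2.1, smul_smul, smul_eq_mul, mul_one]
      congr 2
      · have : F z₂ ≠ 0 := by linarith
        rw [neg_div_neg_eq]; field_simp
      · field_simp
  have hvis := hedge p q hpq hys _ hmem
    (by simp only [map_smul, smul_eq_mul]; have : 0 < N⁻¹ := by positivity
        nlinarith)
    (by simp only [map_smul, smul_eq_mul]; positivity)
  have hx : x = N • (N⁻¹ • x) := by rw [smul_smul, mul_inv_cancel₀ hN0.ne', one_smul]
  constructor
  · intro h
    by_contra! h1
    rw [hx] at h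
    exact H.smul_notMem ⟨p, q, hpq, hmem⟩ h1 h
  · intro h
    rw [hx]
    exact H.smul_mem_of_clear hvis.2 hN0.le h

/-- If the edge across the quadrant does not end at `b`, then there is a radial edge at `b`: the
points of the ray beyond `b` below the edge are limits of the region, but hidden by `b`, and so they
are on the boundary. -/
lemma exists_radial_edge (H : IsStarRegion V Adj I) (hS : IsSector V Adj a b F G) {τ μ : ℝ}
    (hτ : 1 < τ) (hI : ∀ x, F x < 0 → 0 < G x → (x ∈ I ↔ -F x / μ + G x / τ < 1)) :
    ∃ σ : ℝ, 1 < σ ∧ Adj b (σ • b) := by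
  have hd := hS.isDual
  have hbd : ∀ t : ℝ, 1 < t → t < τ → t • b ∈ bdry Adj := by
    intro t ht1 htτ
    by_contra hno
    refine H.smul_notMem (H.mem_bdry hS.right_mem.1) ht1.le (H.closure_sub ?_ hno)
    have hc : Continuous fun ε : ℝ => t • b - ε • a := by fun_prop
    have hlim : Tendsto (fun ε : ℝ => t • b - ε • a) (𝓝[>] 0) (𝓝 (t • b)) := by
      have := hc.tendsto 0
      simp only [zero_smul, sub_zero] at this
      exact this.mono_left nhdsWithin_le_nhds
    have hval : ∀ᶠ ε in 𝓝[>] (0 : ℝ), ε / μ + t / τ < 1 := by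
      have hc' : Continuous fun ε : ℝ => ε / μ + t / τ := by fun_prop
      have := hc'.tendsto 0
      simp only [zero_div, zero_add] at this
      exact (this.mono_left nhdsWithin_le_nhds).eventually
        (eventually_lt_nhds ((div_lt_one (by linarith)).2 htτ))
    refine mem_closure_of_tendsto hlim ?_
    filter_upwards [hval, self_mem_nhdsWithin] with ε h1 h2
    have h2' : 0 < ε := h2
    refine (hI _ ?_ ?_).2 ?_ <;>
      simp only [map_sub, map_smul, hd.1, hd.2.1, hd.2.2.1, hd.2.2.2.1, smul_eq_mul]
    · linarith
    · linarith
    · simpa using h1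
  have hev : ∀ᶠ t in 𝓝[>] (1 : ℝ), ∃ e ∈ V ×ˢ V, Adj e.1 e.2 ∧ t • b ∈ segment ℝ e.1 e.2 := by
    filter_upwards [self_mem_nhdsWithin, (eventually_lt_nhds hτ).filter_mono nhdsWithin_le_nhds]
      with t h1 h2
    obtain ⟨c, d, hcd, hs⟩ := hbd t h1 h2
    exact ⟨(c, d), ⟨H.left_mem hcd, H.right_mem hcd⟩, hcd, hs⟩
  -- A single edge contains points of the ray arbitrarily close to `b`, beyond `b`.
  obtain ⟨⟨c, d⟩, -, hfr⟩ : ∃ e ∈ V ×ˢ V, ∃ᶠ t in 𝓝[>] (1 : ℝ),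
      Adj e.1 e.2 ∧ t • b ∈ segment ℝ e.1 e.2 := by
    by_contra! h
    have h' := (eventually_all_finite (H.finite.prod H.finite)).2 h
    obtain ⟨t, ⟨e, he, h1⟩, h2⟩ := (hev.and h').exists
    exact h2 e he h1.1 h1.2
  obtain ⟨-, hcd, -⟩ := hfr.exists
  have hbs : b ∈ segment ℝ c d := by
    have hcl : IsClosed (segment ℝ c d) := by
      rw [← convexHull_pair]
      exact ((Set.toFinite {c, d}).isCompact_convexHull ℝ).isClosed
    have hlim : Tendsto (fun t : ℝ => t • b) (𝓝[>] 1) (𝓝 b) := by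
      have hc : Continuous fun t : ℝ => t • b := by fun_prop
      have := hc.tendsto 1
      rw [one_smul] at this
      exact this.mono_left nhdsWithin_le_nhds
    exact hcl.mem_of_frequently_of_tendsto (hfr.mono fun t ht => ht.2) hlim
  obtain ⟨e, hbe, t, ht1, hts⟩ : ∃ e, Adj b e ∧ ∃ t : ℝ, 1 < t ∧ t • b ∈ segment ℝ b e := by
    obtain ⟨t, ⟨-, hts⟩, ht1⟩ := (hfr.and_eventually self_mem_nhdsWithin).exists
    rcases H.vertex_on_edge hS.right_mem.1 hcd hbs with h | h
    · exact ⟨d, h ▸ hcd, t, ht1, h ▸ hts⟩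
    · exact ⟨c, h ▸ H.symm hcd, t, ht1, by rw [segment_symm]; exact h ▸ hts⟩
  obtain ⟨s, s0, s1, hs⟩ := mem_segment_iff.1 hts
  have hb0 : b ≠ 0 := H.ne_zero_of_mem_bdry (H.mem_bdry hS.right_mem.1)
  have s0' : 0 < s := by
    refine lt_of_le_of_ne s0 ?_
    rintro rfl
    have := congrArg G hs
    simp [hd.2.2.2.1] at this
    linarith
  refine ⟨1 + (t - 1) / s, by have := div_pos (sub_pos.2 ht1) s0'; linarith, ?_⟩
  have : e = (1 + (t - 1) / s) • b := by
    have h1 : s • e = (t - (1 - s)) • b := by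
      have : s • e = t • b - (1 - s) • b := by rw [hs]; module
      rw [this]; module
    have h2 : 1 + (t - 1) / s = s⁻¹ * (t - (1 - s)) := by field_simp; ring
    rw [h2, mul_smul, ← h1, smul_smul, inv_mul_cancel₀ s0'.ne', one_smul]
  rwa [← this]

/-- A radial edge at `b` is not seen from the side of `a`, if the region also extends along it on
the other side: otherwise the region would surround `b` on both sides of its ray, and there would be
no room for the second edge at `b`. -/
lemma not_subset_of_radial (H : IsStarRegion V Adj I) (hS : IsSector V Adj a b F G) {τ μ σ : ℝ}
    (hτ : 1 < τ) (hI : ∀ x, F x < 0 → 0 < G x → (x ∈ I ↔ -F x / μ + G x / τ < 1))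
    (hσ : 1 < σ) (hadj : Adj b (σ • b)) {p : Plane} (hFp : 0 < F p) {κ : ℝ} (hκ : 1 < κ) :
    ¬ openSegment ℝ p (κ • b) ⊆ I := by
  intro hsub
  have hd := hS.isDual
  obtain ⟨e, hef, hbe⟩ := H.exists_ne_adj hadj
  have hmem : ∀ ε : ℝ, 0 ≤ ε → ε ≤ 1 → (1 - ε) • b + ε • e ∈ bdry Adj := fun ε h0 h1 =>
    ⟨b, e, hbe, mem_segment_iff.2 ⟨ε, h0, h1, rfl⟩⟩
  have hsmall : ∀ᶠ ε in 𝓝[>] (0 : ℝ), 0 < ε ∧ ε ≤ 1 := by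
    filter_upwards [self_mem_nhdsWithin,
      (eventually_lt_nhds one_pos).filter_mono nhdsWithin_le_nhds] with ε h1 h2
    exact ⟨h1, h2.le⟩
  rcases lt_trichotomy (F e) 0 with hFe | hFe | hFe
  · have hN : ((-μ⁻¹) • F + τ⁻¹ • G) b < 1 := by
      simp only [LinearMap.add_apply, LinearMap.smul_apply, hd.2.1, hd.2.2.2.1, smul_eq_mul,
        mul_zero, mul_one, zero_add]
      exact inv_lt_one_of_one_lt₀ hτ
    obtain ⟨ε, ⟨h1, h2⟩, h3⟩ := ((hsmall.and (eventually_lt_along G (y := b) e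
      (r := 0) (by rw [hd.2.2.2.1]; exact one_pos))).and (eventually_gt_along _ e hN)).exists
    refine H.notMem_bdry ((hI _ ?_ h2).2 ?_) (hmem ε h1.1.le h1.2)
    · rw [map_convex, hd.2.1]; nlinarith
    · simp only [LinearMap.add_apply, LinearMap.smul_apply, smul_eq_mul] at h3
      rw [div_eq_inv_mul, div_eq_inv_mul]; linarith
  · have hez : e = G e • b := by
      conv_lhs => rw [hd.2.2.2.2 e, hFe, zero_smul, zero_add]
    have hnn : 0 ≤ G e := by
      by_contra! h
      obtain ⟨s, s0, s1, hs⟩ := exists_zero_on_segment (continuous_functional G) (x := b) (y := e)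
        (by rw [hd.2.2.2.1]; exact zero_le_one) h.le
      have hz := hd.2.2.2.2 ((1 - s) • b + s • e)
      rw [hs, map_convex, hFe, hd.2.1] at hz
      simp only [mul_zero, add_zero, zero_smul] at hz
      exact H.zero_notMem (hz ▸ hmem s s0 s1)
    rcases lt_trichotomy (G e) 1 with h | h | h
    · exact hS.right_mem.2 _ hnn h (hez ▸ H.mem_bdry (H.right_mem hbe))
    · rw [h, one_smul] at hez
      exact H.ne hbe hez.symm
    · -- The two edges would overlap beyond `b`.
      obtain ⟨t, ht1, ht2⟩ := exists_between (lt_min h hσ)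
      have hseg : ∀ ρ : ℝ, t < ρ → t • b ∈ segment ℝ b (ρ • b) := by
        intro ρ hρ
        have h0 : 0 < ρ - 1 := by linarith
        refine mem_segment_iff.2 ⟨(t - 1) / (ρ - 1), div_nonneg (by linarith) h0.le, ?_, ?_⟩
        · rw [div_le_one h0]; linarith
        · rw [smul_smul, ← add_smul]
          congr 1; field_simp; ring
      have hG1 : ∀ ρ : ℝ, G (ρ • b) = ρ := fun ρ => by simp [hd.2.2.2.1]
      rcases H.simple hadj hbe (hseg σ (lt_min_iff.1 ht2).2)
        (hez ▸ hseg _ (lt_min_iff.1 ht2).1) with h' | h' | h' | h'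
      · exact hef h'.2
      · exact H.ne hadj h'.1
      · have := congrArg G h'
        rw [hG1, hd.2.2.2.1] at this; linarith
      · have := congrArg G h'
        rw [hG1, hG1] at this; linarith [(lt_min_iff.1 ht2).2]
  · have hcr : cross p (κ • b) ≠ 0 := by
      rw [hd.cross_eq]
      simp only [map_smul, hd.2.1, hd.2.2.2.1, smul_eq_mul, mul_zero, mul_one, sub_zero]
      exact mul_ne_zero (mul_ne_zero hFp.ne' (by linarith)) hS.cross_ne
    obtain ⟨f, g, hd'⟩ := exists_isDual hcr
    have hfb : f b = 0 := by
      have := hd'.2.1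
      rw [map_smul, smul_eq_mul] at this
      exact (mul_eq_zero.1 this).resolve_left (by linarith)
    have hgb : κ * g b = 1 := by simpa using hd'.2.2.2.1
    have hgb0 : 0 < g b := by nlinarith
    have hgb1 : g b < 1 := by nlinarith
    have hfe : 0 < f e := by
      have h1 : F e = f e * F p := by
        conv_lhs => rw [hd'.2.2.2.2 e]
        simp [hd.2.1]
      rw [h1] at hFe
      exact (pos_iff_pos_of_mul_pos hFe).2 hFp
    obtain ⟨ε, ⟨h1, h2⟩, h3⟩ := ((hsmall.and (eventually_lt_along g e hgb0)).and
      (eventually_gt_along (f + g) (y := b) (r := 1) e (by simpa [hfb] using hgb1))).exists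
    set z := (1 - ε) • b + ε • e with hz
    have hfz : 0 < f z := by
      rw [hz, map_convex, hfb]; have := mul_pos h1.1 hfe; linarith
    rw [LinearMap.add_apply] at h3
    have hpos : 0 < f z + g z := by linarith
    refine H.notMem_bdry ?_ (hmem ε h1.1.le h1.2)
    have hx : (f z + g z)⁻¹ • z ∈ I := by
      refine hsub (hd'.mem_openSegment ?_ ?_ ?_)
      · simp only [map_smul, smul_eq_mul]; positivity
      · simp only [map_smul, smul_eq_mul]; positivity
      · simp only [map_smul, smul_eq_mul]; field_simp
    have := H.smul_mem hx hpos.le h3.le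
    rwa [smul_smul, mul_inv_cancel₀ hpos.ne', one_smul] at this

lemma finite_inCone (H : IsStarRegion V Adj I) : (inCone V Adj F G).Finite :=
  H.finite.subset fun _ hv => hv.1.1

lemma zero_notMem_inCone (H : IsStarRegion V Adj I) : (0 : Plane) ∉ inCone V Adj F G :=
  fun h => H.ne_zero_of_mem_bdry (H.mem_bdry h.1.1) rfl

/-- Every nonzero vector of the cone of a sector lies in the cone of a hull pair. -/
lemma exists_hullPair_inCone (H : IsStarRegion V Adj I) (hS : IsSector V Adj a b F G) {m : Plane}
    (hm : m ≠ 0) (hF : 0 ≤ F m) (hG : 0 ≤ G m) :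
    ∃ u w, IsHullPair (inCone V Adj F G) u w ∧ ∃ f g, IsDual u w f g ∧ 0 ≤ f m ∧ 0 ≤ g m := by
  have hd := hS.isDual
  obtain ⟨u, w, hp, h1, h2⟩ := Starshaped.exists_hullPair H.finite_inCone hd hS.cross_ne
    ⟨hS.left_mem, by rw [hd.1]; exact zero_le_one, hd.2.2.1.ge⟩
    ⟨hS.right_mem, hd.2.1.ge, by rw [hd.2.2.2.1]; exact zero_le_one⟩
    H.zero_notMem_inCone (fun v hv => hv.2) hm hF hG
  obtain ⟨f, g, hd'⟩ := exists_isDual hp.cross_ne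
  refine ⟨u, w, hp, f, g, hd', ?_, ?_⟩
  · rwa [(hd'.coord_eq hp.cross_ne m).1]
  · rwa [(hd'.coord_eq hp.cross_ne m).2]

/-- A point of a hull segment is not on the boundary rays of the cone. -/
lemma pos_of_mem_hullPair (hS : IsSector V Adj a b F G) {u w p : Plane}
    (hp : IsHullPair (inCone V Adj F G) u w) (hpm : p ∈ openSegment ℝ u w) : 0 < F p := by
  obtain ⟨s, s0, s1, rfl⟩ := mem_openSegment_iff.1 hpm
  have hu := hp.left_mem.2.1
  have hw := hp.right_mem.2.1
  rw [map_convex]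
  by_contra! h
  have s1' := sub_pos.2 s1
  have h1 : F u = 0 := by nlinarith [mul_nonneg s1'.le hu, mul_nonneg s0.le hw]
  have h2 : F w = 0 := by nlinarith [mul_nonneg s1'.le hu, mul_nonneg s0.le hw]
  apply hp.cross_ne
  rw [hS.isDual.cross_eq, h1, h2]; ring

/-- If the edge across the quadrant ends at `b`, then a hull segment with endpoint `b` sees all
points of the region in the quadrant. The reason is that `a` is not below the line of the hull
segment, so that the edge stays below this line. -/
lemma exists_sees_of_edge_at (H : IsStarRegion V Adj I) (hS : IsSector V Adj a b F G) {μ : ℝ}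
    (hμ : 0 < μ) (hI : ∀ x, F x < 0 → 0 < G x → (x ∈ I ↔ -F x / μ + G x < 1)) :
    ∃ u w, IsHullPair (inCone V Adj F G) u w ∧ ∀ l ∈ I, F l < 0 → 0 < G l →
      ∃ p ∈ openSegment ℝ u w, openSegment ℝ l p ⊆ I := by
  have hd := hS.isDual
  have hb0 : b ≠ 0 := H.ne_zero_of_mem_bdry (H.mem_bdry hS.right_mem.1)
  obtain ⟨u, f, g, hp, hd'⟩ : ∃ u f g, IsHullPair (inCone V Adj F G) u b ∧ IsDual u b f g := by
    obtain ⟨u, w, hp, f, g, hd', hf, hg⟩ := H.exists_hullPair_inCone hS hb0 hd.2.1.ge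
      (by rw [hd.2.2.2.1]; exact zero_le_one)
    have key : ∀ u w f g, IsHullPair (inCone V Adj F G) u w → IsDual u w f g → 0 ≤ g b →
        f b = 0 → w = b := by
      intro u w f g hp hd' hg h
      have hbw : b = g b • w := by
        conv_lhs => rw [hd'.2.2.2.2 b, h, zero_smul, zero_add]
      have hg' : 0 < g b := by
        refine lt_of_le_of_ne hg fun h' => hb0 ?_
        rw [hbw, ← h', zero_smul]
      exact (H.exposed_unique hp.right_mem.1 hS.right_mem hg' hbw).symm
    have hFb : f b * F u + g b * F w = 0 := by
      have := hd.2.1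
      rw [hd'.2.2.2.2 b] at this
      simpa using this
    have hu := hp.left_mem.2.1
    have hw := hp.right_mem.2.1
    rcases hf.lt_or_eq with hf | hf
    · rcases hg.lt_or_eq with hg | hg
      · exfalso
        have h1 : F u = 0 := by nlinarith [mul_nonneg hf.le hu, mul_nonneg hg.le hw]
        have h2 : F w = 0 := by nlinarith [mul_nonneg hf.le hu, mul_nonneg hg.le hw]
        apply hp.cross_ne
        rw [hd.cross_eq, h1, h2]; ring
      · obtain rfl := key w u g f hp.symm hd'.symm hf.le hg.symm
        exact ⟨w, g, f, hp.symm, hd'.symm⟩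
    · obtain rfl := key u w f g hp hd' hg hf.symm
      exact ⟨u, f, g, hp, hd'⟩
  refine ⟨u, b, hp, fun l hl hFl hGl => ?_⟩
  have hNl := (hI l hFl hGl).1 hl
  have hLa : 1 ≤ f a + g a := hp.one_le f g hd' a
    ⟨hS.left_mem, by rw [hd.1]; exact zero_le_one, hd.2.2.1.ge⟩
  have hFu : 0 < F u := by
    refine lt_of_le_of_ne hp.left_mem.2.1 fun h => hp.cross_ne ?_
    rw [hd.cross_eq, ← h, hd.2.1]; ring
  have hGu := hp.left_mem.2.2
  have hF : ∀ x, F x = f x * F u := fun x => by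
    conv_lhs => rw [hd'.2.2.2.2 x]
    simp [hd.2.1]
  have hG : ∀ x, G x = f x * G u + g x := fun x => by
    conv_lhs => rw [hd'.2.2.2.2 x]
    simp [hd.2.2.2.1]
  have hL : ∀ x, f x + g x = F x * (f a + g a) + G x := fun x => by
    conv_lhs => rw [hd.2.2.2.2 x]
    simp only [map_add, map_smul, smul_eq_mul, hd'.2.1, hd'.2.2.2.1]
    ring
  obtain ⟨p, hpm⟩ := nonempty_openSegment u b
  have hpc := hd'.of_mem_openSegment hpm
  refine ⟨p, hpm, fun z hz => ?_⟩
  obtain ⟨s, s0, s1, rfl⟩ := mem_openSegment_iff.1 hz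
  have s1' := sub_pos.2 s1
  have hNl' : -F l / μ > 0 := div_pos (by linarith) hμ
  have hfl : f l < 0 := by
    have := hF l; by_contra! h
    nlinarith [mul_nonneg h hFu.le]
  have hgl : 0 < g l := by
    have := hG l
    nlinarith [mul_nonneg (neg_pos.2 hfl).le hGu]
  have hLl : f l + g l < 1 := by
    have := hL l
    nlinarith
  set z := (1 - s) • l + s • p with hzdef
  have hfz : f z = (1 - s) * f l + s * f p := by rw [hzdef, map_convex]
  have hgz : g z = (1 - s) * g l + s * g p := by rw [hzdef, map_convex]
  have hgz0 : 0 < g z := by rw [hgz]; have := hpc.2.1; positivity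
  have hLz : f z + g z < 1 := by rw [hfz, hgz]; nlinarith [hpc.2.2]
  rcases le_or_gt 0 (f z) with h | h
  · exact H.mem_of_hullPair hp hd' h hgz0.le hLz
  · have hFz : F z < 0 := by rw [hF]; nlinarith
    have hFp : 0 < F p := by rw [hF]; exact mul_pos hpc.1 hFu
    have hGp : 0 ≤ G p := by rw [hG]; have := hpc.1; have := hpc.2.1; positivity
    have hGz : G z = (1 - s) * G l + s * G p := by rw [hzdef, map_convex]
    have hFz' : F z = (1 - s) * F l + s * F p := by rw [hzdef, map_convex]
    refine (hI z hFz (by rw [hGz]; positivity)).2 ?_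
    have hGp1 : G p ≤ 1 := by
      have := hL p
      nlinarith [hpc.2.2]
    have hdiv : -F z / μ = (1 - s) * (-F l / μ) - s * (F p / μ) := by
      rw [hFz']; field_simp; ring
    have : 0 < F p / μ := div_pos hFp hμ
    rw [hdiv, hGz]
    nlinarith [mul_pos s0 this, mul_lt_mul_of_pos_left hNl s1']

/-- The points of the region in the quadrant beyond `b` are seen by a hull segment, or by one
additional guard. This guard is a radial edge at `b`, which is hidden from everything on the other
side of the ray of `b`. -/
lemma exists_side_guard (H : IsStarRegion V Adj I) (hS : IsSector V Adj a b F G) :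
    ∃ R : Set (Set Plane), R.Subsingleton ∧
      (∀ s ∈ R, ∃ c d, Adj c d ∧ s = openSegment ℝ c d) ∧
      (∀ s ∈ R, ∀ q ∈ s, 0 < G q ∧ ∀ p, 0 < F p → p ≠ q ∧ ¬ openSegment ℝ p q ⊆ I) ∧
      ∀ l ∈ I, F l < 0 → 0 < G l → (∃ s ∈ R, ∃ p ∈ s, openSegment ℝ l p ⊆ I) ∨
        ∃ u w, IsHullPair (inCone V Adj F G) u w ∧
          ∃ p ∈ openSegment ℝ u w, openSegment ℝ l p ⊆ I := by
  have hd := hS.isDual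
  obtain ⟨c, d, hcd, τ, μ, hτ0, hμ, hτs, hI⟩ := H.exists_edge_across hS
  rcases lt_trichotomy τ 1 with hτ | rfl | hτ
  · exact absurd ⟨c, d, hcd, hτs⟩ (hS.right_mem.2 τ hτ0.le hτ)
  · simp only [div_one] at hI
    obtain ⟨u, w, hp, hsee⟩ := H.exists_sees_of_edge_at hS hμ hI
    exact ⟨∅, subsingleton_empty, by simp, by simp,
      fun l hl h1 h2 => Or.inr ⟨u, w, hp, hsee l hl h1 h2⟩⟩
  · obtain ⟨σ, hσ, hadj⟩ := H.exists_radial_edge hS hτ hI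
    have hseg : ∀ z ∈ openSegment ℝ b (σ • b), ∃ κ : ℝ, 1 < κ ∧ z = κ • b := by
      intro z hz
      obtain ⟨s, s0, s1, rfl⟩ := mem_openSegment_iff.1 hz
      refine ⟨1 - s + s * σ, by nlinarith, ?_⟩
      rw [add_smul, mul_smul]
    refine ⟨{openSegment ℝ b (σ • b)}, subsingleton_singleton, ?_, ?_, fun l hl h1 h2 => ?_⟩
    · rintro s rfl
      exact ⟨b, σ • b, hadj, rfl⟩
    · rintro s rfl q hq
      obtain ⟨κ, hκ, rfl⟩ := hseg q hq
      have hGq : G (κ • b) = κ := by simp [hd.2.2.2.1]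
      refine ⟨by rw [hGq]; linarith, fun p hp => ⟨?_, ?_⟩⟩
      · rintro rfl
        simp [hd.2.1] at hp
      · exact H.not_subset_of_radial hS hτ hI hσ hadj hp hκ
    · left
      obtain ⟨t, ht1, ht2⟩ := exists_between (lt_min hσ hτ)
      have htσ := (lt_min_iff.1 ht2).1
      have htτ := (lt_min_iff.1 ht2).2
      refine ⟨_, rfl, t • b, ?_, fun z hz => ?_⟩
      · have h0 : 0 < σ - 1 := by linarith
        refine mem_openSegment_iff.2 ⟨(t - 1) / (σ - 1), div_pos (by linarith) h0, ?_, ?_⟩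
        · rw [div_lt_one h0]; linarith
        · rw [smul_smul, ← add_smul]
          congr 1; field_simp; ring
      · obtain ⟨s, s0, s1, rfl⟩ := mem_openSegment_iff.1 hz
        have s1' := sub_pos.2 s1
        have hNl := (hI l h1 h2).1 hl
        have hNb : t / τ < 1 := (div_lt_one hτ0).2 htτ
        refine (hI _ ?_ ?_).2 ?_ <;>
          simp only [map_convex, map_smul, hd.2.1, hd.2.2.2.1, smul_eq_mul, mul_zero, mul_one,
            add_zero]
        · nlinarith
        · have : 0 < t := by linarith
          positivity
        · have : -((1 - s) * F l) / μ + ((1 - s) * G l + s * t) / τ =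
              (1 - s) * (-F l / μ + G l / τ) + s * (t / τ) := by ring
          rw [this]
          nlinarith [mul_lt_mul_of_pos_left hNl s1', mul_lt_mul_of_pos_left hNb s0]

end IsStarRegion
end Starshaped

namespace Starshaped

/-! ### The hidden guard set -/

/-- The open segments of all hull pairs in a maximal cone, together with at most one radial edge on
each of the two rays bounding the cone, guard the region and are mutually hidden. -/
theorem IsStarRegion.exists_hidden_guards {V : Set Plane} {Adj : Plane → Plane → Prop}
    {I : Set Plane} (H : IsStarRegion V Adj I) :
    ∃ S : Set (Set Plane),
      (∀ s ∈ S, (∃ c d, Adj c d ∧ s = openSegment ℝ c d) ∨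
        ∃ u ∈ V, ∃ w ∈ V, u ≠ w ∧ ¬ Adj u w ∧ openSegment ℝ u w ⊆ I ∧ s = openSegment ℝ u w) ∧
      (∀ l ∈ I, ∃ s ∈ S, ∃ p ∈ s, openSegment ℝ l p ⊆ I) ∧
      ∀ s ∈ S, ∀ t ∈ S, s ≠ t → ∀ p ∈ s, ∀ q ∈ t, p ≠ q ∧ ¬ openSegment ℝ p q ⊆ I := by
  obtain ⟨a, ha, b, hb, hab, hquad⟩ := H.exists_maximal_pair
  obtain ⟨F, G, hd⟩ := exists_isDual hab
  have hS : IsSector V Adj a b F G := ⟨ha, hb, hab, hd, hquad F G hd⟩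
  obtain ⟨R₁, hs₁, hadj₁, hhid₁, hsee₁⟩ := H.exists_side_guard hS
  obtain ⟨R₂, hs₂, hadj₂, hhid₂, hsee₂⟩ := H.exists_side_guard hS.symm
  rw [inCone_comm] at hsee₂
  set Q : Set (Set Plane) :=
    {s | ∃ u w, IsHullPair (inCone V Adj F G) u w ∧ s = openSegment ℝ u w} with hQ
  have hcomm : ∀ {p q : Plane}, (p ≠ q ∧ ¬ openSegment ℝ p q ⊆ I) →
      (q ≠ p ∧ ¬ openSegment ℝ q p ⊆ I) := fun h => ⟨h.1.symm, by rw [openSegment_symm]; exact h.2⟩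
  have hQ₁ : ∀ s ∈ Q, ∀ p ∈ s, 0 < F p := by
    rintro s ⟨u, w, hp, rfl⟩ p hpm
    exact pos_of_mem_hullPair hS hp hpm
  have hQ₂ : ∀ s ∈ Q, ∀ p ∈ s, 0 < G p := by
    rintro s ⟨u, w, hp, rfl⟩ p hpm
    rw [inCone_comm] at hp
    exact pos_of_mem_hullPair hS.symm hp hpm
  refine ⟨Q ∪ (R₁ ∪ R₂), ?_, ?_, ?_⟩
  · rintro s (⟨u, w, hp, rfl⟩ | h | h)
    · by_cases hadj : Adj u w
      · exact Or.inl ⟨u, w, hadj, rfl⟩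
      · refine Or.inr ⟨u, hp.left_mem.1.1, w, hp.right_mem.1.1, ?_, hadj,
          (H.adj_or_subset_of_hullPair hp).resolve_left hadj, rfl⟩
        rintro rfl
        exact hp.cross_ne (cross_self u)
    · exact Or.inl (hadj₁ s h)
    · exact Or.inl (hadj₂ s h)
  · intro l hl
    have hull : ∀ {u w p : Plane}, IsHullPair (inCone V Adj F G) u w → p ∈ openSegment ℝ u w →
        openSegment ℝ l p ⊆ I → ∃ s ∈ Q ∪ (R₁ ∪ R₂), ∃ p ∈ s, openSegment ℝ l p ⊆ I :=
      fun hp hpm hsub => ⟨_, Or.inl ⟨_, _, hp, rfl⟩, _, hpm, hsub⟩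
    rcases lt_or_ge (F l) 0 with hF | hF
    · rcases lt_or_ge 0 (G l) with hG | hG
      · rcases hsee₁ l hl hF hG with ⟨s, hs, h⟩ | ⟨u, w, hp, p, hpm, hsub⟩
        · exact ⟨s, Or.inr (Or.inl hs), h⟩
        · exact hull hp hpm hsub
      · obtain ⟨u, w, hp, f, g, hd', hf, hg⟩ := H.exists_hullPair_inCone hS (m := -l)
          (by rw [neg_ne_zero]; rintro rfl; simp at hF) (by rw [map_neg]; linarith)
          (by rw [map_neg]; linarith)
        rw [map_neg] at hf hg
        obtain ⟨p, hpm, hsub⟩ := H.exists_sees_of_mem_neg_cone hp hd' hl (by linarith) (by linarith)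
        exact hull hp hpm hsub
    · rcases lt_or_ge (G l) 0 with hG | hG
      · rcases hF.lt_or_eq with hF | hF
        · rcases hsee₂ l hl hG hF with ⟨s, hs, h⟩ | ⟨u, w, hp, p, hpm, hsub⟩
          · exact ⟨s, Or.inr (Or.inr hs), h⟩
          · exact hull hp hpm hsub
        · obtain ⟨u, w, hp, f, g, hd', hf, hg⟩ := H.exists_hullPair_inCone hS (m := -l)
            (by rw [neg_ne_zero]; rintro rfl; simp at hG) (by rw [map_neg]; linarith)
            (by rw [map_neg]; linarith)
          rw [map_neg] at hf hg
          obtain ⟨p, hpm, hsub⟩ :=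
            H.exists_sees_of_mem_neg_cone hp hd' hl (by linarith) (by linarith)
          exact hull hp hpm hsub
      · by_cases hl0 : l = 0
        · -- The origin lies in every cone.
          obtain ⟨u, w, hp, f, g, hd', -, -⟩ := H.exists_hullPair_inCone hS (m := a)
            (H.ne_zero_of_mem_bdry (H.mem_bdry ha.1)) (by rw [hd.1]; exact zero_le_one)
            hd.2.2.1.ge
          obtain ⟨p, hpm, hsub⟩ := H.exists_sees_of_mem_cone hp hd' hl (by simp [hl0])
            (by simp [hl0])
          exact hull hp hpm hsub
        · obtain ⟨u, w, hp, f, g, hd', hf, hg⟩ := H.exists_hullPair_inCone hS hl0 hF hG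
          obtain ⟨p, hpm, hsub⟩ := H.exists_sees_of_mem_cone hp hd' hl hf hg
          exact hull hp hpm hsub
  · rintro s (hs | hs | hs) t (ht | ht | ht) hst p hp q hq
    · obtain ⟨u, w, hp₁, rfl⟩ := hs
      obtain ⟨u', w', hp₂, rfl⟩ := ht
      exact H.not_subset_of_hullPair hp₁ hp₂ hst hp hq
    · exact (hhid₁ t ht q hq).2 p (hQ₁ s hs p hp)
    · exact (hhid₂ t ht q hq).2 p (hQ₂ s hs p hp)
    · exact hcomm ((hhid₁ s hs p hp).2 q (hQ₁ t ht q hq))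
    · exact absurd (hs₁ hs ht) hst
    · exact (hhid₂ t ht q hq).2 p (hhid₁ s hs p hp).1
    · exact hcomm ((hhid₂ s hs p hp).2 q (hQ₂ t ht q hq))
    · exact (hhid₁ t ht q hq).2 p (hhid₂ s hs p hp).1
    · exact absurd (hs₂ hs ht) hst

end Starshaped

namespace Polygon

variable {n : ℕ}

/-! ### Starshaped polygons -/

lemma edgeSet_eq_segment (P : Polygon Plane n) (i : Fin n) :
    P.edgeSet ℝ i = segment ℝ (P i) (P (finRotate n i)) :=
  affineSegment_eq_segment ℝ _ _

lemma isClosed_boundary (P : Polygon Plane n) : IsClosed (P.boundary ℝ) := by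
  refine isClosed_iUnion_of_finite fun i => ?_
  rw [edgeSet_eq_segment, ← convexHull_pair]
  exact ((Set.toFinite {P i, P (finRotate n i)}).isCompact_convexHull ℝ).isClosed

lemma mem_interior_of_mem_component (P : Polygon Plane n) {x y : Plane} (hx : x ∈ P.interior)
    (hy : y ∈ connectedComponentIn (P.boundary ℝ)ᶜ x) : y ∈ P.interior :=
  ⟨connectedComponentIn_subset _ _ hy, connectedComponentIn_eq hy ▸ hx.2⟩

lemma isOpen_interior (P : Polygon Plane n) : IsOpen P.interior := by
  refine isOpen_iff_mem_nhds.2 fun x hx => ?_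
  refine Filter.mem_of_superset (P.isClosed_boundary.isOpen_compl.connectedComponentIn.mem_nhds
    (mem_connectedComponentIn hx.1)) fun y hy => P.mem_interior_of_mem_component hx hy

lemma mem_interior_of_mem_closure (P : Polygon Plane n) {x : Plane} (hx : x ∈ closure P.interior)
    (hb : x ∉ P.boundary ℝ) : x ∈ P.interior := by
  obtain ⟨y, hy, hyI⟩ := mem_closure_iff.1 hx _
    P.isClosed_boundary.isOpen_compl.connectedComponentIn
    (mem_connectedComponentIn (F := (P.boundary ℝ)ᶜ) hb)
  refine P.mem_interior_of_mem_component hyI ?_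
  rw [← connectedComponentIn_eq hy]
  exact mem_connectedComponentIn hb

lemma visible_of_openSegment_subset (P : Polygon Plane n) {p q : Plane}
    (h : openSegment ℝ p q ⊆ P.interior) : P.Visible p q := by
  rintro z ⟨hz, hne⟩
  simp only [mem_insert_iff, mem_singleton_iff, not_or] at hne
  exact h (mem_openSegment_of_ne_left_right (Ne.symm hne.1) (Ne.symm hne.2) hz)

lemma openSegment_subset_of_visible (P : Polygon Plane n) {p q : Plane} (hne : p ≠ q)
    (h : P.Visible p q) : openSegment ℝ p q ⊆ P.interior := by
  intro z hz
  refine h ⟨openSegment_subset_segment ℝ p q hz, ?_⟩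
  rintro (rfl | rfl)
  · exact hne (left_mem_openSegment_iff.1 hz)
  · exact hne (right_mem_openSegment_iff.1 hz)

lemma finRotate_ne {n : ℕ} (hn : 3 ≤ n) (i : Fin n) :
    finRotate n i ≠ i ∧ finRotate n (finRotate n i) ≠ i := by
  obtain ⟨m, rfl⟩ := Nat.exists_eq_add_of_le' hn
  simp only [finRotate_apply, ne_eq]
  constructor
  · simp
  · rw [add_assoc, add_eq_left]
    simp only [Fin.ext_iff, Fin.val_add, Fin.val_one, Fin.val_zero]
    rw [Nat.mod_eq_of_lt (by omega)]; norm_num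

/-- The edges of `P`, translated by `-k`, as a symmetric relation between endpoints. -/
def AdjFrom (P : Polygon Plane n) (k c d : Plane) : Prop :=
  ∃ i, (k + c = P i ∧ k + d = P (finRotate n i)) ∨ (k + d = P i ∧ k + c = P (finRotate n i))

lemma mem_bdry_adjFrom (P : Polygon Plane n) (k x : Plane) :
    x ∈ Starshaped.bdry (P.AdjFrom k) ↔ k + x ∈ P.boundary ℝ := by
  simp only [boundary, mem_iUnion, edgeSet_eq_segment]
  constructor
  · rintro ⟨c, d, ⟨i, h | h⟩, hx⟩
    · exact ⟨i, by rw [← h.1, ← h.2]; exact (mem_segment_translate ℝ k).2 hx⟩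
    · exact ⟨i, by rw [← h.1, ← h.2, segment_symm]; exact (mem_segment_translate ℝ k).2 hx⟩
  · rintro ⟨i, hx⟩
    refine ⟨P i - k, P (finRotate n i) - k, ⟨i, Or.inl ⟨by simp, by simp⟩⟩, ?_⟩
    rw [← mem_segment_translate ℝ k]
    simpa using hx

/-- A starshaped polygon, translated so that a point of its kernel is the origin. -/
lemma isStarRegion (P : Polygon Plane n) (hP : P.IsSimple) {k : Plane} (hk : k ∈ P.interior)
    (hstar : ∀ l ∈ P.interior, P.Visible k l) :
    Starshaped.IsStarRegion {x | k + x ∈ range P.vertices} (P.AdjFrom k)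
      {x | k + x ∈ P.interior} := by
  obtain ⟨hn, hinj, hsim⟩ := hP
  have hseg : ∀ x : Plane, (∀ t : ℝ, 0 ≤ t → t ≤ 1 → k + t • x ∉ P.boundary ℝ) →
      k + x ∈ connectedComponentIn (P.boundary ℝ)ᶜ k := by
    intro x hx
    refine (convex_segment k (k + x)).isPreconnected.subset_connectedComponentIn
      (left_mem_segment ℝ _ _) ?_ (right_mem_segment ℝ _ _)
    intro z hz
    rw [segment_eq_image'] at hz
    obtain ⟨t, ht, rfl⟩ := hz
    simpa using hx t ht.1 ht.2
  refine ⟨?_, ?_, ?_, ?_, ?_, ?_, ?_, ?_, ?_, ?_, ?_, ?_⟩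
  · exact (finite_range P.vertices).preimage (add_right_injective k).injOn
  · rintro c d ⟨i, h | h⟩
    · exact ⟨i, Or.inr h⟩
    · exact ⟨i, Or.inl h⟩
  · rintro c d ⟨i, h | h⟩
    · exact ⟨i, h.1.symm⟩
    · exact ⟨finRotate n i, h.2.symm⟩
  · rintro c d ⟨i, h | h⟩ rfl
    · exact (finRotate_ne hn i).1 (hinj (h.2.symm.trans h.1))
    · exact (finRotate_ne hn i).1 (hinj (h.2.symm.trans h.1))
  · rintro v ⟨i, hi⟩
    exact ⟨P (finRotate n i) - k, i, Or.inl ⟨hi.symm, by simp⟩⟩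
  · rintro v f ⟨i, h | h⟩
    · refine ⟨P ((finRotate n).symm i) - k, ?_, (finRotate n).symm i,
        Or.inr ⟨by simp, by rw [Equiv.apply_symm_apply]; exact h.1⟩⟩
      rintro rfl
      have := h.2
      simp only [add_sub_cancel] at this
      have h2 := hinj this
      refine (finRotate_ne hn ((finRotate n).symm i)).2 ?_
      rw [Equiv.apply_symm_apply]; exact h2.symm
    · refine ⟨P (finRotate n (finRotate n i)) - k, ?_, finRotate n i, Or.inl ⟨h.2, by simp⟩⟩
      rintro rfl
      have := h.1
      simp only [add_sub_cancel] at this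
      exact (finRotate_ne hn i).2 (hinj this)
  · intro c d c' d' x hcd hcd' hx hx'
    rw [← mem_segment_translate ℝ k] at hx hx'
    obtain ⟨i, hi⟩ := hcd
    obtain ⟨j, hj⟩ := hcd'
    have hx₁ : k + x ∈ P.edgeSet ℝ i := by
      rw [edgeSet_eq_segment]
      rcases hi with h | h
      · rwa [← h.1, ← h.2]
      · rwa [← h.1, ← h.2, segment_symm]
    have hx₂ : k + x ∈ P.edgeSet ℝ j := by
      rw [edgeSet_eq_segment]
      rcases hj with h | h
      · rwa [← h.1, ← h.2]
      · rwa [← h.1, ← h.2, segment_symm]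
    have cancel : ∀ {y z : Plane} {w : Plane}, k + y = w → k + z = w → y = z := by
      intro y z w h1 h2
      exact add_left_cancel (h1.trans h2.symm)
    by_cases hij : i = j
    · subst hij
      rcases hi with h | h <;> rcases hj with h' | h'
      · exact Or.inl ⟨cancel h'.1 h.1, cancel h'.2 h.2⟩
      · exact Or.inr (Or.inl ⟨cancel h'.2 h.2, cancel h'.1 h.1⟩)
      · exact Or.inr (Or.inl ⟨cancel h'.1 h.1, cancel h'.2 h.2⟩)
      · exact Or.inl ⟨cancel h'.2 h.2, cancel h'.1 h.1⟩
    · right; right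
      rcases hsim i j hij (k + x) ⟨hx₁, hx₂⟩ with ⟨h1, h2⟩ | ⟨h1, h2⟩
      · rw [h1] at h2
        rcases hi with h | h
        · exact Or.inr (cancel h2 h.2)
        · exact Or.inl (cancel h2 h.2)
      · rcases hi with h | h
        · exact Or.inl (cancel h2 h.1)
        · exact Or.inr (cancel h2 h.1)
  · rw [mem_bdry_adjFrom, add_zero]; exact hk.1
  · intro x
    simp only [mem_bdry_adjFrom]
    constructor
    · intro hx t t0 t1
      have hz : k + t • x ∈ segment ℝ k (k + x) := by
        rw [segment_eq_image']; exact ⟨t, ⟨t0, t1⟩, by simp⟩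
      by_cases h1 : k + t • x = k
      · rw [h1]; exact hk.1
      by_cases h2 : k + t • x = k + x
      · rw [h2]; exact hx.1
      refine (hstar _ hx ⟨hz, ?_⟩).1
      simp only [mem_insert_iff, mem_singleton_iff, not_or]
      exact ⟨h1, h2⟩
    · intro hx
      exact P.mem_interior_of_mem_component hk (hseg x hx)
  · -- A ray that misses the boundary would lie in a bounded component.
    intro x hx
    by_contra! hno
    simp only [mem_bdry_adjFrom] at hno
    obtain ⟨C, hC⟩ := hk.2.exists_norm_le
    have hxn : 0 < ‖x‖ := norm_pos_iff.2 hx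
    set T := (|C| + ‖k‖ + 1) / ‖x‖ with hT
    have hT0 : 0 < T := by positivity
    have hmem : k + T • x ∈ connectedComponentIn (P.boundary ℝ)ᶜ k := by
      refine hseg _ fun t t0 t1 => ?_
      rcases t0.lt_or_eq with t0 | rfl
      · rw [smul_smul]; exact hno _ (by positivity)
      · rw [zero_smul, add_zero]; exact hk.1
    have h1 := hC _ hmem
    have h2 : ‖T • x‖ = |C| + ‖k‖ + 1 := by
      rw [norm_smul, Real.norm_of_nonneg hT0.le, hT]; field_simp
    have h3 : ‖T • x‖ ≤ ‖k + T • x‖ + ‖k‖ := by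
      have := norm_sub_le (k + T • x) k
      simpa using this
    linarith [le_abs_self C]
  · exact P.isOpen_interior.preimage (continuous_const.add continuous_id)
  · intro x hx hb
    rw [mem_bdry_adjFrom] at hb
    refine P.mem_interior_of_mem_closure ?_ hb
    exact (continuous_const.add continuous_id).closure_preimage_subset P.interior hx

end Polygon

theorem mainTheorem1 (n : ℕ) (P : Polygon Plane n) (hP : P.IsStarshaped) :
    ∃ S : Set (Set Plane), P.IsOpenMobileGuardSet S ∧ P.IsHidden S := by
  obtain ⟨hsimple, k, hk, hstar⟩ := hP
  obtain ⟨S, hguard, hsee, hhid⟩ := (P.isStarRegion hsimple hk hstar).exists_hidden_guards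
  have himg : ∀ u w : Plane, (fun x => k + x) '' openSegment ℝ u w =
      openSegment ℝ (k + u) (k + w) := fun u w => openSegment_translate_image ℝ k u w
  have hsub : ∀ u w : Plane, openSegment ℝ u w ⊆ {x | k + x ∈ P.interior} ↔
      openSegment ℝ (k + u) (k + w) ⊆ P.interior := by
    intro u w
    rw [← himg, image_subset_iff]; rfl
  refine ⟨(fun s => (fun x => k + x) '' s) '' S, ⟨?_, ?_⟩, ?_⟩
  · rintro _ ⟨s, hs, rfl⟩
    rcases hguard s hs with ⟨c, d, ⟨i, h | h⟩, rfl⟩ | ⟨u, ⟨i, hi⟩, w, ⟨j, hj⟩, hne, hnadj, hI, rfl⟩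
    · exact Or.inl ⟨i, by simp only [himg, h.1, h.2]⟩
    · exact Or.inl ⟨i, by simp only [himg, h.1, h.2]; rw [openSegment_symm]⟩
    · refine Or.inr ⟨i, j, ?_, ?_, ?_, ?_, ?_⟩
      · rintro rfl
        exact hne (add_left_cancel (hi.symm.trans hj))
      · rintro rfl
        exact hnadj ⟨i, Or.inl ⟨hi.symm, hj.symm⟩⟩
      · rintro rfl
        exact hnadj ⟨j, Or.inr ⟨hj.symm, hi.symm⟩⟩
      · rw [hi, hj]; exact (hsub u w).1 hI
      · simp only [himg, hi, hj]
  · intro l hl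
    obtain ⟨s, hs, p, hp, h⟩ := hsee (l - k) (by simpa using hl)
    refine ⟨_, ⟨s, hs, rfl⟩, k + p, ⟨p, hp, rfl⟩, P.visible_of_openSegment_subset ?_⟩
    have := (hsub _ _).1 h
    rwa [add_sub_cancel] at this
  · rintro _ ⟨s, hs, rfl⟩ _ ⟨t, ht, rfl⟩ hne ⟨_, ⟨p, hp, rfl⟩, _, ⟨q, hq, rfl⟩, hvis⟩
    obtain ⟨hpq, hnot⟩ := hhid s hs t ht (fun h => hne (by rw [h])) p hp q hq
    exact hnot ((hsub p q).2
      (P.openSegment_subset_of_visible (fun h => hpq (add_left_cancel h)) hvis))
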